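/- Let $\{Y_n\}$ be an irreducible aperiodic Markov chain on a finite set $S$ with transition probabilities $p(j|i)$ and stationary distribution $\pi$, let $r:S\to\mathbb R$, $0<\gamma<1$, $d\ge 1$, and let $\varphi(i)\in\mathbb R^d$ ($i\in S$) be feature vectors such that the $|S|\times d$ matrix $\Phi$ with rows $\varphi(i)^T$ has linearly independent columns. Let $\|\cdot\|$ be the Euclidean norm, $\mathbf D=\mathrm{diag}(\pi)$, $\|v\|_{\mathbf D}^2=\sum_i\pi(i)v(i)^2$, and let $\lambda_M$ be the largest singular value of $\Phi^T\sqrt{\mathbf D}$. Assume $$\lambda_M<\frac{\sqrt{2(1-\gamma)}}{1+\gamma}.$$ Put $\alpha=\sqrt{1-\min_{x\ne 0}\frac{\|\Phi x\|_{\mathbf D}^2}{\|x\|^2}\big(2(1-\gamma)-\lambda_M^2(1+\gamma)^2\big)}$ and $$F(x,i)=\varphi(i)r(i)+\gamma\varphi(i)\sum_jp(j|i)\varphi(j)^Tx-\varphi(i)\varphi(i)^Tx+x .$$ Then $\alpha<1$ and the map $x\mapsto\sum_i\pi(i)F(x,i)$ has exactly one fixed point $x^*\in\mathbb R^d$. Let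 $a(n)$ be non-increasing stepsizes with $a(n)<1$ and $\frac{d_1}{n+1}\le a(n)\le d_3\big(\frac1{n+1}\big)^{d_2}$ for all $n\ge0$, where $d_1>0$ and $0<d_2\le 1$, and consider the TD(0) iterates $$x_{n+1}=x_n+a(n)\varphi(Y_n)\big(r(Y_n)+\gamma\varphi(Y_{n+1})^Tx_n-\varphi(Y_n)^Tx_n\big),\qquad n\ge 0,$$ along one sample path, where $Y_0$ and $x_0$ may be random and $\{Y_n\}$ is Markov with respect to $\mathcal F_n=\sigma(x_0,Y_0,\dots,Y_n)$. Let $b_k(n)=\sum_{m=k}^na(m)$ (zero if $n<k$), and let $\beta_k(n)=\frac{1}{k^{d_2-d_1}n^{d_1}}$ if $d_1\le d_2$ and $\beta_k(n)=n^{-d_2}$ otherwise. There are finite positive constants $c_1,c_2,c_3$, depending only on the chain, the features, the rewards and $\gamma$, and a constant $D>0$, depending in addition only on the stepsizes and on $d_1,d_2,d_3$ (the constant $c_3$ does not occur in the bounds below), such that for all $0<\delta\le1$, $0<\epsilon\le1$, all $n_0>0$ with $\alpha+a(n_0)c_1<1$, and all $n\ge n_0$: (a) the inequality $$\|x_m-x^*\|\le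 e^{-(1-\alpha)b_{n_0}(m-1)}\epsilon+\frac{a(n_0)(c_2+c_1\epsilon)+\delta}{1-\alpha-a(n_0)c_1}\qquad\text{for all } n_0\le m\le n$$ holds with probability at least $$1-2d\sum_{m=n_0+1}^ne^{-D\delta^2/\beta_{n_0}(m)}-P(\|x_{n_0}-x^*\|>\epsilon),$$ and with probability exceeding this number if $n>n_0$; (b) the same inequality for all $m\ge n_0$ holds with probability exceeding $$1-2d\sum_{m\ge n_0+1}e^{-D\delta^2/\beta_{n_0}(m)}-P(\|x_{n_0}-x^*\|>\epsilon),$$ where the series converges. -/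

import Mathlib

open MeasureTheory

namespace TD0

noncomputable section

/-! ### The Markov chain -/

/-- A square matrix with nonnegative entries, indexed by the states of a chain, is aperiodic if for
every state `i` the greatest common divisor of the return times `{n > 0 : (P ^ n) i i > 0}` is `1`,
i.e. `1` is the only common divisor of these times. -/
def IsAperiodic {S : Type*} [Fintype S] [DecidableEq S] (P : Matrix S S ℝ) : Prop :=
  ∀ i : S, ∀ k : ℕ, (∀ n : ℕ, 0 < n → 0 < (P ^ n) i i → k ∣ n) → k = 1

/-- `π` is a stationary distribution of the transition matrix `P`, where `P i j = p(j | i)`. -/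
structure IsStationary {S : Type*} [Fintype S] (P : Matrix S S ℝ) (π : S → ℝ) : Prop where
  nonneg : ∀ i, 0 ≤ π i
  sum_eq_one : ∑ i, π i = 1
  stationary : ∀ j, ∑ i, π i * P i j = π j

/-- The `σ`-algebra `ℱ n = σ(x₀, Y₀, …, Yₙ)`. -/
abbrev history {S Ω : Type*} [MeasurableSpace S] {d : ℕ}
    (x₀ : Ω → EuclideanSpace ℝ (Fin d)) (Y : ℕ → Ω → S) (n : ℕ) : MeasurableSpace Ω :=
  MeasurableSpace.comap x₀ inferInstance ⊔ ⨆ k ≤ n, MeasurableSpace.comap (Y k) inferInstance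

/-- `Y` is a Markov chain with transition matrix `P` with respect to `ℱ n = σ(x₀, Y₀, …, Yₙ)`:
the conditional probability of `Y (n + 1) = j` given `ℱ n` is `P (Y n) j`. The initial state and
the (possibly random) initial iterate `x₀` are arbitrary. -/
structure IsMarkovChain {S Ω : Type*} [MeasurableSpace S] [MeasurableSpace Ω] {d : ℕ}
    (P : Matrix S S ℝ) (μ : Measure Ω)
    (x₀ : Ω → EuclideanSpace ℝ (Fin d)) (Y : ℕ → Ω → S) : Prop where
  measurable_init : Measurable x₀
  measurable_state : ∀ n, Measurable (Y n)
  transition : ∀ (n : ℕ) (j : S),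
    μ[(Y (n + 1) ⁻¹' {j}).indicator (fun _ => (1 : ℝ)) | history x₀ Y n]
      =ᵐ[μ] fun ω => P (Y n ω) j

/-! ### Features and contraction factor -/

/-- The feature matrix `Φ`, whose `i`-th row is the feature vector `φ i` of the state `i`. -/
def featureMatrix {S : Type*} {d : ℕ} (φ : S → EuclideanSpace ℝ (Fin d)) :
    Matrix S (Fin d) ℝ :=
  Matrix.of fun i l => φ i l

/-- The matrix `Ψ = Φᵀ √D` with `D = diag π`. -/
def psiMatrix {S : Type*} [Fintype S] [DecidableEq S] {d : ℕ} (π : S → ℝ)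
    (φ : S → EuclideanSpace ℝ (Fin d)) : Matrix (Fin d) S ℝ :=
  (featureMatrix φ).transpose * Matrix.diagonal fun i => Real.sqrt (π i)

/-- `λ_M`, the largest singular value of `Ψ` (singular values are listed in decreasing order,
starting from index `0`). -/
def lambdaM {S : Type*} [Fintype S] [DecidableEq S] {d : ℕ} (π : S → ℝ)
    (φ : S → EuclideanSpace ℝ (Fin d)) : ℝ :=
  (Matrix.toLpLin 2 2 (psiMatrix π φ)).singularValues 0

/-- The squared weighted norm `‖v‖_D ^ 2 = ∑ i, π i * v i ^ 2`. -/
def sqNormD {S : Type*} [Fintype S] (π : S → ℝ) (v : S → ℝ) : ℝ :=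
  ∑ i, π i * v i ^ 2

/-- The contraction factor
`α = √(1 - min_{x ≠ 0} (‖Φ x‖_D² / ‖x‖²) * (2 (1 - γ) - λ_M² (1 + γ)²))`. -/
def contractionFactor {S : Type*} [Fintype S] [DecidableEq S] {d : ℕ} (π : S → ℝ) (γ : ℝ)
    (φ : S → EuclideanSpace ℝ (Fin d)) : ℝ :=
  Real.sqrt (1 -
    (⨅ x : {x : EuclideanSpace ℝ (Fin d) // x ≠ 0},
      sqNormD π ((featureMatrix φ).mulVec fun l => x.1 l) / ‖x.1‖ ^ 2) *
    (2 * (1 - γ) - lambdaM π φ ^ 2 * (1 + γ) ^ 2))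

/-- `F(x, i) = φ(i) r(i) + γ φ(i) ∑ⱼ p(j | i) φ(j)ᵀ x - φ(i) φ(i)ᵀ x + x`. -/
def driftF {S : Type*} [Fintype S] {d : ℕ} (P : Matrix S S ℝ) (γ : ℝ) (r : S → ℝ)
    (φ : S → EuclideanSpace ℝ (Fin d)) (x : EuclideanSpace ℝ (Fin d)) (i : S) :
    EuclideanSpace ℝ (Fin d) :=
  r i • φ i + (γ * ∑ j, P i j * inner ℝ (φ j) x) • φ i - (inner ℝ (φ i) x) • φ i + x

/-- The averaged map `x ↦ ∑ i, π(i) F(x, i)`. -/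
def meanF {S : Type*} [Fintype S] {d : ℕ} (P : Matrix S S ℝ) (π : S → ℝ) (γ : ℝ) (r : S → ℝ)
    (φ : S → EuclideanSpace ℝ (Fin d)) (x : EuclideanSpace ℝ (Fin d)) :
    EuclideanSpace ℝ (Fin d) :=
  ∑ i, π i • driftF P γ r φ x i

/-! ### Stepsizes and the algorithm -/

/-- The assumptions on the stepsizes. The bounds imply that the stepsizes are positive, tend to
`0` and have a divergent sum. -/
structure IsStepsize (a : ℕ → ℝ) (d₁ d₂ d₃ : ℝ) : Prop where
  d₁_pos : 0 < d₁
  d₂_pos : 0 < d₂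
  d₂_le_one : d₂ ≤ 1
  antitone : ∀ n, a (n + 1) ≤ a n
  lt_one : ∀ n, a n < 1
  lower : ∀ n : ℕ, d₁ / ((n : ℝ) + 1) ≤ a n
  upper : ∀ n : ℕ, a n ≤ d₃ * (1 / ((n : ℝ) + 1)) ^ d₂

/-- The TD(0) iterates along the trajectory `y`, started at `x₀`:
`x (n+1) = x n + a n • φ(y n) (r(y n) + γ φ(y (n+1))ᵀ x n - φ(y n)ᵀ x n)`. -/
def iterate {S : Type*} {d : ℕ} (γ : ℝ) (r : S → ℝ) (φ : S → EuclideanSpace ℝ (Fin d))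
    (a : ℕ → ℝ) (y : ℕ → S) (x₀ : EuclideanSpace ℝ (Fin d)) :
    ℕ → EuclideanSpace ℝ (Fin d)
  | 0 => x₀
  | n + 1 =>
    let x := iterate γ r φ a y x₀ n
    x + (a n * (r (y n) + γ * inner ℝ (φ (y (n + 1))) x - inner ℝ (φ (y n)) x)) • φ (y n)

/-- `b_k(n) = ∑_{m = k}^{n} a(m)` (an empty sum if `n < k`). -/
def bSum (a : ℕ → ℝ) (k n : ℕ) : ℝ := ∑ m ∈ Finset.Icc k n, a m

/-- `β_k(n) = 1 / (k^(d₂ - d₁) n^d₁)` if `d₁ ≤ d₂`, and `1 / n^d₂` otherwise. -/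
def beta (d₁ d₂ : ℝ) (k n : ℕ) : ℝ :=
  if d₁ ≤ d₂ then 1 / ((k : ℝ) ^ (d₂ - d₁) * (n : ℝ) ^ d₁) else 1 / (n : ℝ) ^ d₂

/-- The error bound
`e^{-(1-α) b_{n₀}(m-1)} ε + (a(n₀) (c₂ + c₁ ε) + δ) / (1 - α - a(n₀) c₁)`. It is used for
`1 ≤ n₀ ≤ m` only; at `m = n₀` the exponent is an empty sum. -/
def errorBound (α : ℝ) (a : ℕ → ℝ) (c₁ c₂ δ ε : ℝ) (n₀ m : ℕ) : ℝ :=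
  Real.exp (-(1 - α) * bSum a n₀ (m - 1)) * ε +
    (a n₀ * (c₂ + c₁ * ε) + δ) / (1 - α - a n₀ * c₁)

end

end TD0

/-!
Write the algorithm as `x (n + 1) = x n + a n g(x n, Y n, Y (n + 1))`, and let
`T x = ∑ i, π i F(x, i)`.

*Contraction.* `T x - T y = u + Φᵀ D (γ P - I) Φ u` with `u = x - y`. Expanding the square, the cross
term is at most `-2 (1 - γ) ‖Φ u‖_D²`, since `P` does not increase `‖·‖_D`, and the last term is at
most `λ_M² (1 + γ)² ‖Φ u‖_D²`. Hence `T` is a contraction with factor `α`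
(`norm_meanF_sub_meanF_le`), and `α < 1` because `Φ` is injective and `π` is positive.

*Decomposition.* The matrix `G = (I - P + 1 πᵀ)⁻¹` solves the Poisson equation for the chain
(`exists_fundamental_matrix`), so that with `V(x, i) = ∑ j, G i j F(x, j)` one has
`g(x, i, j) = T x - x + N(x, i, j) + V(x, i) - V(x, j)`, where the noise `N(x, Y n, Y (n + 1))` has
conditional mean zero (`tdIncrement_eq`).

*Pathwise bound.* Let `z` be the noiseless iteration `z (n + 1) = z n + a n (T (z n) - z n)` started
at `x n₀`; it approaches the fixed point at the rate `exp (-(1 - α) b)`. The difference `x - z` is a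
sum of three discounted sums, all obeying `w (n + 1) = (1 - a n) w n + a n f n`. If `x - z` is
bounded by `B` up to time `n - 1`, then at time `n` the one of `T x - T z` is at most `α B`, the one
of the noise is at most `δ` on the good event, and the one of `V(x n, Y n) - V(x n, Y (n + 1))` is at
most `4 a(n₀)` times a bound for `V`, by summation by parts (`norm_discountedSum_sub_le`). For
`B = (a(n₀) (c₂ + c₁ ε) + δ) / (1 - α - a(n₀) c₁)` these add up to `B`, which closes the induction
(`norm_sub_le_of_discountedSum_le`).

*Concentration.* On the good event the iterates stay in a ball whose radius depends on the stepsizes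
only, so the noise may be truncated outside this ball. Azuma's inequality, applied to each
coordinate (`IsMarkovChain.measure_norm_discountedSum_le`), bounds the probability that the
discounted noise exceeds `δ` in terms of the sum of the squared weights. That sum satisfies
`s (n + 1) = (1 - a n)² s n + a n²` and is at most a multiple of `β` by induction
(`IsStepsize.discountedVariance_le`). A union bound over the times concludes.
-/

namespace TD0

/-! ### Finite irreducible chains -/

section Chain

variable {S : Type*} [Fintype S] {P : Matrix S S ℝ} {π : S → ℝ}

theorem IsStationary.vecMul_eq (hπ : IsStationary P π) : Matrix.vecMul π P = π := by
  ext j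
  simpa [Matrix.vecMul, dotProduct] using hπ.stationary j

theorem IsStationary.pos [DecidableEq S] (hirr : P.IsIrreducible) (hπ : IsStationary P π) (j : S) :
    0 < π j := by
  obtain ⟨i, hi⟩ : ∃ i, 0 < π i := by
    by_contra! h
    have h₁ : ∑ i, π i ≤ 0 := Finset.sum_nonpos fun i _ => h i
    rw [hπ.sum_eq_one] at h₁
    linarith
  obtain ⟨k, -, hk⟩ := (Matrix.isIrreducible_iff_exists_pow_pos hirr.nonneg).1 hirr i j
  have hpow : ∀ k : ℕ, Matrix.vecMul π (P ^ k) = π := by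
    intro k
    induction k with
    | zero => simp
    | succ k ih => rw [pow_succ, ← Matrix.vecMul_vecMul, ih, hπ.vecMul_eq]
  have hkj : ∑ l, π l * (P ^ k) l j = π j := by
    simpa [Matrix.vecMul, dotProduct] using congrFun (hpow k) j
  rw [← hkj]
  exact Finset.sum_pos' (fun l _ => mul_nonneg (hπ.nonneg l)
    (Matrix.pow_apply_nonneg hirr.nonneg k l j))
    ⟨i, Finset.mem_univ i, mul_pos hi hk⟩

/-- Maximum principle: a harmonic function of an irreducible stochastic matrix is constant. -/
theorem eq_of_mulVec_eq [DecidableEq S] (hP : P ∈ Matrix.rowStochastic ℝ S)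
    (hirr : P.IsIrreducible) {v : S → ℝ} (hv : P.mulVec v = v) (i j : S) : v i = v j := by
  have : Nonempty S := ⟨i⟩
  obtain ⟨i₀, hi₀⟩ := Finite.exists_max v
  suffices h : ∀ j, v j = v i₀ by rw [h i, h j]
  intro j
  by_contra hne
  have hlt : v j < v i₀ := lt_of_le_of_ne (hi₀ j) hne
  obtain ⟨k, -, hk⟩ := (Matrix.isIrreducible_iff_exists_pow_pos hirr.nonneg).1 hirr i₀ j
  have hpow : (P ^ k).mulVec v = v := by
    clear hk
    induction k with
    | zero => simp
    | succ k ih => rw [pow_succ, ← Matrix.mulVec_mulVec, hv, ih]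
  have hPk : P ^ k ∈ Matrix.rowStochastic ℝ S := pow_mem hP k
  have h₁ : ∑ l, (P ^ k) i₀ l * v l = v i₀ := by
    simpa [Matrix.mulVec, dotProduct] using congrFun hpow i₀
  have h₂ : ∑ l, (P ^ k) i₀ l * v l < ∑ l, (P ^ k) i₀ l * v i₀ :=
    Finset.sum_lt_sum
      (fun l _ => mul_le_mul_of_nonneg_left (hi₀ l) (Matrix.nonneg_of_mem_rowStochastic hPk))
      ⟨j, Finset.mem_univ j, mul_lt_mul_of_pos_left hlt hk⟩
  rw [← Finset.sum_mul, Matrix.sum_row_of_mem_rowStochastic hPk, one_mul, h₁] at h₂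
  exact lt_irrefl _ h₂

/-- Solvability of the Poisson equation: there is a matrix `G` with `(I - P) G = I - 1 πᵀ`, namely
the fundamental matrix `(I - P + 1 πᵀ)⁻¹`. -/
theorem exists_fundamental_matrix [DecidableEq S] (hP : P ∈ Matrix.rowStochastic ℝ S)
    (hirr : P.IsIrreducible) (hπ : IsStationary P π) :
    ∃ G : Matrix S S ℝ, ∀ i k, G i k - ∑ j, P i j * G j k = (1 : Matrix S S ℝ) i k - π k := by
  set Z : Matrix S S ℝ := 1 - P + Matrix.of fun _ j => π j with hZ
  have hπZ : Matrix.vecMul π Z = π := by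
    rw [hZ, Matrix.vecMul_add, Matrix.vecMul_sub, hπ.vecMul_eq, Matrix.vecMul_one, sub_self,
      zero_add]
    ext j
    simp [Matrix.vecMul, dotProduct, ← Finset.sum_mul, hπ.sum_eq_one]
  have hinj : Function.Injective Z.mulVec := by
    rw [← Matrix.coe_mulVecLin, ← LinearMap.ker_eq_bot, LinearMap.ker_eq_bot']
    intro v hv
    rw [Matrix.coe_mulVecLin] at hv
    have h₀ : π ⬝ᵥ v = 0 := by
      rw [← hπZ, ← Matrix.dotProduct_mulVec, hv, dotProduct_zero]
    have h₁ : P.mulVec v = v := by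
      ext i
      have h := congrFun hv i
      have h₂ : (Matrix.of fun _ j => π j : Matrix S S ℝ).mulVec v i = 0 := by
        simpa [Matrix.mulVec, dotProduct] using h₀
      rw [hZ, Matrix.add_mulVec, Matrix.sub_mulVec, Matrix.one_mulVec, Pi.add_apply, h₂,
        Pi.sub_apply, Pi.zero_apply] at h
      linarith
    ext i
    have h₃ : π ⬝ᵥ v = v i := by
      rw [dotProduct, Finset.sum_congr rfl fun j _ => by
        rw [eq_of_mulVec_eq hP hirr h₁ j i], ← Finset.sum_mul, hπ.sum_eq_one, one_mul]
    rw [← h₃, h₀, Pi.zero_apply]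
  have hunit : IsUnit Z := Matrix.mulVec_injective_iff_isUnit.1 hinj
  have hZG : Z * Z⁻¹ = 1 := Matrix.mul_nonsing_inv Z ((Matrix.isUnit_iff_isUnit_det Z).1 hunit)
  have hπG : Matrix.vecMul π Z⁻¹ = π := by
    conv_lhs => rw [← hπZ]
    rw [Matrix.vecMul_vecMul, hZG, Matrix.vecMul_one]
  refine ⟨Z⁻¹, fun i k => ?_⟩
  have h := congrFun (congrFun hZG i) k
  have h₁ : ((Matrix.of fun _ j => π j : Matrix S S ℝ) * Z⁻¹) i k = π k := by
    rw [← congrFun hπG k]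
    simp [Matrix.mul_apply, Matrix.vecMul, dotProduct]
  conv_lhs at h => rw [hZ, ← hZ]
  have h₂ : (Z * Z⁻¹) i k
      = Z⁻¹ i k - ∑ j, P i j * Z⁻¹ j k + ((Matrix.of fun _ j => π j : Matrix S S ℝ) * Z⁻¹) i k := by
    conv_lhs => enter [1]; rw [hZ]
    rw [add_mul, sub_mul, one_mul, Matrix.add_apply, Matrix.sub_apply, Matrix.mul_apply]
  rw [h₂, h₁] at h
  linarith

/-- Jensen's inequality for the averaging operator of a chain in its stationary law. -/
theorem sqNormD_mulVec_le [DecidableEq S] (hP : P ∈ Matrix.rowStochastic ℝ S)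
    (hπ : IsStationary P π) (v : S → ℝ) :
    sqNormD π (P.mulVec v) ≤ sqNormD π v := by
  have hjensen : ∀ i, (P.mulVec v i) ^ 2 ≤ ∑ j, P i j * v j ^ 2 := by
    intro i
    have h := (even_two.convexOn_pow (𝕜 := ℝ)).map_sum_le (t := Finset.univ) (w := P i) (p := v)
      (fun j _ => Matrix.nonneg_of_mem_rowStochastic hP)
      (Matrix.sum_row_of_mem_rowStochastic hP i) (fun j _ => Set.mem_univ _)
    simpa [Matrix.mulVec, dotProduct] using h
  calc sqNormD π (P.mulVec v) ≤ ∑ i, π i * ∑ j, P i j * v j ^ 2 :=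
        Finset.sum_le_sum fun i _ => mul_le_mul_of_nonneg_left (hjensen i) (hπ.nonneg i)
    _ = ∑ j, (∑ i, π i * P i j) * v j ^ 2 := by
        simp_rw [Finset.mul_sum, Finset.sum_mul]
        rw [Finset.sum_comm]
        simp [mul_assoc]
    _ = sqNormD π v := by simp [hπ.stationary, sqNormD]

end Chain

/-! ### Contraction of the mean map -/

/-- The largest singular value bounds the operator norm. -/
theorem norm_le_singularValues_zero_mul {E F : Type*} [NormedAddCommGroup E]
    [InnerProductSpace ℝ E] [FiniteDimensional ℝ E] [NormedAddCommGroup F] [InnerProductSpace ℝ F]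
    [FiniteDimensional ℝ F] (T : E →ₗ[ℝ] F) (x : E) : ‖T x‖ ≤ T.singularValues 0 * ‖x‖ := by
  have hS := T.isSymmetric_adjoint_comp_self
  set b := hS.eigenvectorBasis rfl with hb
  refine le_of_sq_le_sq ?_ (mul_nonneg (T.singularValues_nonneg 0) (norm_nonneg x))
  have h₁ : ‖T x‖ ^ 2
      = ∑ i : Fin (Module.finrank ℝ E), T.singularValues i ^ 2 * inner ℝ x (b i) ^ 2 := by
    rw [← real_inner_self_eq_norm_sq, ← LinearMap.adjoint_inner_left, ← b.sum_inner_mul_inner]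
    refine Finset.sum_congr rfl fun i _ => ?_
    have h₂ := hS x (b i)
    rw [hS.apply_eigenvectorBasis rfl i, inner_smul_right] at h₂
    rw [LinearMap.comp_apply] at h₂
    rw [h₂, T.sq_singularValues_fin rfl i, real_inner_comm x (b i)]
    simp only [RCLike.ofReal_real_eq_id, id]
    ring
  have h₃ : ‖x‖ ^ 2 = ∑ i, inner ℝ x (b i) ^ 2 := by
    rw [← real_inner_self_eq_norm_sq, ← b.sum_inner_mul_inner]
    refine Finset.sum_congr rfl fun i _ => ?_
    rw [real_inner_comm x (b i)]
    ring
  rw [mul_pow, h₁, h₃, Finset.mul_sum]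
  refine Finset.sum_le_sum fun i _ => mul_le_mul_of_nonneg_right ?_ (sq_nonneg _)
  exact pow_le_pow_left₀ (T.singularValues_nonneg _) (T.singularValues_antitone (Nat.zero_le _)) 2

theorem featureMatrix_mulVec {S : Type*} {d : ℕ} {φ : S → EuclideanSpace ℝ (Fin d)}
    (x : EuclideanSpace ℝ (Fin d)) (i : S) :
    (featureMatrix φ).mulVec (fun l => x l) i = inner ℝ (φ i) x := by
  simp [featureMatrix, Matrix.mulVec, dotProduct, PiLp.inner_apply, mul_comm]

theorem exists_fixedPoint {E : Type*} [NormedAddCommGroup E] [CompleteSpace E] {T : E → E} {α : ℝ}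
    (hα₀ : 0 ≤ α) (hα₁ : α < 1) (hT : ∀ x y, ‖T x - T y‖ ≤ α * ‖x - y‖) :
    ∃ p, ∀ x, T x = x ↔ x = p := by
  have hc : ContractingWith ⟨α, hα₀⟩ T := by
    refine ⟨hα₁, LipschitzWith.of_dist_le_mul fun x y => ?_⟩
    rw [dist_eq_norm, dist_eq_norm]
    exact hT x y
  refine ⟨ContractingWith.fixedPoint T hc, fun x => ⟨fun hx => hc.fixedPoint_unique hx, ?_⟩⟩
  rintro rfl
  exact hc.fixedPoint_isFixedPt

section Contraction

variable {S : Type*} [Fintype S] {d : ℕ} {P : Matrix S S ℝ} {π : S → ℝ} {γ : ℝ}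
  {r : S → ℝ} {φ : S → EuclideanSpace ℝ (Fin d)}

theorem sqNormD_nonneg (hπ : ∀ i, 0 ≤ π i) (v : S → ℝ) : 0 ≤ sqNormD π v :=
  Finset.sum_nonneg fun i _ => mul_nonneg (hπ i) (sq_nonneg _)

theorem lambdaM_nonneg [DecidableEq S] : 0 ≤ lambdaM π φ := LinearMap.singularValues_nonneg _ _

/-- `‖Φᵀ D w‖ ≤ λ_M ‖w‖_D`, since `Φᵀ D w = (Φᵀ √D) (√D w)`. -/
theorem norm_sum_smul_le [DecidableEq S] (hπ : ∀ i, 0 ≤ π i) (w : S → ℝ) :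
    ‖∑ i, (π i * w i) • φ i‖ ≤ lambdaM π φ * Real.sqrt (sqNormD π w) := by
  have h := norm_le_singularValues_zero_mul (Matrix.toLpLin 2 2 (psiMatrix π φ))
    (WithLp.toLp 2 fun i => Real.sqrt (π i) * w i)
  have h₁ : Matrix.toLpLin 2 2 (psiMatrix π φ) (WithLp.toLp 2 fun i => Real.sqrt (π i) * w i)
      = ∑ i, (π i * w i) • φ i := by
    ext l
    rw [Matrix.toLpLin_apply]
    simp only [psiMatrix, featureMatrix, Matrix.mulVec, dotProduct, Matrix.mul_diagonal,
      Matrix.transpose_apply, Matrix.of_apply, WithLp.ofLp_sum, WithLp.ofLp_smul, Finset.sum_apply,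
      Pi.smul_apply, smul_eq_mul]
    refine Finset.sum_congr rfl fun i _ => ?_
    linear_combination (w i * φ i l) * Real.mul_self_sqrt (hπ i)
  have h₂ : ‖WithLp.toLp 2 fun i => Real.sqrt (π i) * w i‖ = Real.sqrt (sqNormD π w) := by
    rw [EuclideanSpace.norm_eq, sqNormD]
    congr 1
    refine Finset.sum_congr rfl fun i _ => ?_
    simp [mul_pow, Real.sq_sqrt (hπ i)]
  rw [h₁, h₂] at h
  exact h

/-- The Rayleigh quotient `min_{x ≠ 0} ‖Φ x‖_D² / ‖x‖²` occurring in the contraction factor. -/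
noncomputable def featureRayleigh (π : S → ℝ) (φ : S → EuclideanSpace ℝ (Fin d)) : ℝ :=
  ⨅ x : {x : EuclideanSpace ℝ (Fin d) // x ≠ 0},
    sqNormD π ((featureMatrix φ).mulVec fun l => x.1 l) / ‖x.1‖ ^ 2

theorem featureRayleigh_mul_le (hπ : ∀ i, 0 ≤ π i) (x : EuclideanSpace ℝ (Fin d)) :
    featureRayleigh π φ * ‖x‖ ^ 2 ≤ sqNormD π fun i => inner ℝ (φ i) x := by
  by_cases hx : x = 0
  · simpa [hx] using sqNormD_nonneg hπ _
  · have hx' : 0 < ‖x‖ := norm_pos_iff.2 hx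
    rw [← le_div_iff₀ (by positivity)]
    refine (ciInf_le ⟨0, ?_⟩ (⟨x, hx⟩ : {x : EuclideanSpace ℝ (Fin d) // x ≠ 0})).trans_eq ?_
    · rintro _ ⟨y, rfl⟩
      exact div_nonneg (sqNormD_nonneg hπ _) (sq_nonneg _)
    · simp only [funext (featureMatrix_mulVec x)]

theorem featureRayleigh_pos (hd : 1 ≤ d) (hπ : ∀ i, 0 < π i)
    (hφ : LinearIndependent ℝ fun (l : Fin d) (i : S) => φ i l) : 0 < featureRayleigh π φ := by
  -- The map `x ↦ √D Φ x` is an injective linear map on a finite-dimensional space.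
  let T : EuclideanSpace ℝ (Fin d) →ₗ[ℝ] EuclideanSpace ℝ S :=
    { toFun := fun x => WithLp.toLp 2 fun i => Real.sqrt (π i) * inner ℝ (φ i) x
      map_add' := fun x y => by ext i; simp [inner_add_right, mul_add]
      map_smul' := fun c x => by ext i; simp [inner_smul_right]; ring }
  have hT : ∀ x, ‖T x‖ ^ 2 = sqNormD π fun i => inner ℝ (φ i) x := by
    intro x
    rw [EuclideanSpace.norm_sq_eq, sqNormD]
    refine Finset.sum_congr rfl fun i _ => ?_
    simp [T, mul_pow, Real.sq_sqrt (hπ i).le]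
  have hker : LinearMap.ker T = ⊥ := by
    rw [LinearMap.ker_eq_bot']
    intro x hx
    have hi : ∀ i, inner ℝ (φ i) x = 0 := by
      intro i
      have h := congrArg (fun y : EuclideanSpace ℝ S => y i) hx
      simpa [T, (Real.sqrt_pos.2 (hπ i)).ne'] using h
    ext l
    refine Fintype.linearIndependent_iff.1 hφ (fun l => x l) ?_ l
    ext i
    have h := hi i
    rw [← featureMatrix_mulVec] at h
    simpa [featureMatrix, Matrix.mulVec, dotProduct, mul_comm] using h
  obtain ⟨K, hK, hKT⟩ := T.exists_antilipschitzWith hker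
  have hK' : (0 : ℝ) < K := hK
  have : Nonempty {x : EuclideanSpace ℝ (Fin d) // x ≠ 0} := by
    have : Nonempty (Fin d) := ⟨⟨0, hd⟩⟩
    obtain ⟨x, hx⟩ := exists_ne (0 : EuclideanSpace ℝ (Fin d))
    exact ⟨⟨x, hx⟩⟩
  refine lt_of_lt_of_le (b := 1 / (K : ℝ) ^ 2) (by positivity) (le_ciInf fun x => ?_)
  have hx : 0 < ‖x.1‖ := norm_pos_iff.2 x.2
  rw [funext (featureMatrix_mulVec x.1), ← hT, div_le_div_iff₀ (by positivity) (by positivity),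
    one_mul, ← mul_pow]
  refine pow_le_pow_left₀ hx.le ?_ 2
  have h := hKT.le_mul_dist x.1 0
  simp only [map_zero, dist_zero_right] at h
  linarith [mul_comm (K : ℝ) ‖T x.1‖]

theorem contractionFactor_eq [DecidableEq S] : contractionFactor π γ φ
    = Real.sqrt (1 - featureRayleigh π φ * (2 * (1 - γ) - lambdaM π φ ^ 2 * (1 + γ) ^ 2)) := rfl

theorem lambdaM_sq_mul_lt [DecidableEq S] (hγ₀ : 0 < γ) (hγ₁ : γ < 1)
    (hscale : lambdaM π φ < Real.sqrt (2 * (1 - γ)) / (1 + γ)) :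
    lambdaM π φ ^ 2 * (1 + γ) ^ 2 < 2 * (1 - γ) := by
  rw [lt_div_iff₀ (by linarith)] at hscale
  rw [← mul_pow]
  refine (Real.lt_sqrt (mul_nonneg lambdaM_nonneg (by linarith))).1 hscale

theorem contractionFactor_lt_one [DecidableEq S] (hd : 1 ≤ d) (hπ : ∀ i, 0 < π i)
    (hγ₀ : 0 < γ) (hγ₁ : γ < 1)
    (hφ : LinearIndependent ℝ fun (l : Fin d) (i : S) => φ i l)
    (hscale : lambdaM π φ < Real.sqrt (2 * (1 - γ)) / (1 + γ)) : contractionFactor π γ φ < 1 := by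
  rw [contractionFactor_eq, Real.sqrt_lt' one_pos]
  have h₁ := featureRayleigh_pos hd hπ hφ
  have h₂ := lambdaM_sq_mul_lt hγ₀ hγ₁ hscale
  nlinarith [mul_pos h₁ (sub_pos.2 h₂)]

theorem meanF_sub_meanF (hπ : IsStationary P π) (x y : EuclideanSpace ℝ (Fin d)) :
    meanF P π γ r φ x - meanF P π γ r φ y = (x - y) + ∑ i, (π i *
      (γ * P.mulVec (fun j => inner ℝ (φ j) (x - y)) i - inner ℝ (φ i) (x - y))) • φ i := by
  have h : x - y = ∑ i, π i • (x - y) := by rw [← Finset.sum_smul, hπ.sum_eq_one, one_smul]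
  rw [meanF, meanF, ← Finset.sum_sub_distrib]
  conv_rhs => enter [1]; rw [h]
  rw [← Finset.sum_add_distrib]
  refine Finset.sum_congr rfl fun i _ => ?_
  have h₁ : P.mulVec (fun j => inner ℝ (φ j) (x - y)) i
      = ∑ j, P i j * inner ℝ (φ j) x - ∑ j, P i j * inner ℝ (φ j) y := by
    simp [Matrix.mulVec, dotProduct, inner_sub_right, mul_sub, Finset.sum_sub_distrib]
  rw [h₁, inner_sub_right, driftF, driftF]
  module

/-- Expanding `‖u + Φᵀ D (γ P - I) Φ u‖²`: the cross term is at most `-2 (1 - γ) ‖Φ u‖_D²` because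
`P` is a contraction in `‖·‖_D`, and the square is at most `λ_M² (1 + γ)² ‖Φ u‖_D²`. -/
theorem norm_meanF_sub_meanF_le [DecidableEq S] (hP : P ∈ Matrix.rowStochastic ℝ S)
    (hπ : IsStationary P π)
    (hγ₀ : 0 < γ) (hγ₁ : γ < 1) (hscale : lambdaM π φ < Real.sqrt (2 * (1 - γ)) / (1 + γ))
    (x y : EuclideanSpace ℝ (Fin d)) :
    ‖meanF P π γ r φ x - meanF P π γ r φ y‖ ≤ contractionFactor π γ φ * ‖x - y‖ := by
  rw [meanF_sub_meanF hπ, contractionFactor_eq]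
  set u := x - y with hu
  set v : S → ℝ := fun i => inner ℝ (φ i) u with hv
  set w : S → ℝ := fun i => γ * P.mulVec v i - v i with hw
  set s := sqNormD π v with hs
  have hs₀ : 0 ≤ s := sqNormD_nonneg hπ.nonneg v
  have hPv : sqNormD π (P.mulVec v) ≤ s := sqNormD_mulVec_le hP hπ v
  -- `|⟨P v, v⟩_D| ≤ s`, in both directions, by the arithmetic-geometric mean inequality
  have hcross : ∀ σ : ℝ, σ ^ 2 = 1 → σ * ∑ i, π i * (P.mulVec v i * v i) ≤ s := by
    intro σ hσ
    have h : σ * ∑ i, π i * (P.mulVec v i * v i) ≤ (sqNormD π (P.mulVec v) + s) / 2 := by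
      rw [hs, sqNormD, sqNormD, ← Finset.sum_add_distrib, Finset.sum_div, Finset.mul_sum]
      refine Finset.sum_le_sum fun i _ => ?_
      have := mul_nonneg (hπ.nonneg i) (sq_nonneg (P.mulVec v i - σ * v i))
      have h₁ : π i * (P.mulVec v i - σ * v i) ^ 2 = π i * P.mulVec v i ^ 2
        - 2 * σ * (π i * (P.mulVec v i * v i)) + σ ^ 2 * (π i * v i ^ 2) := by ring
      rw [hσ] at h₁
      linarith
    linarith
  have hc₁ := hcross 1 (by norm_num)
  have hc₂ := hcross (-1) (by norm_num)
  have hinner : inner ℝ u (∑ i, (π i * w i) • φ i) ≤ (γ - 1) * s := by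
    have h : inner ℝ u (∑ i, (π i * w i) • φ i)
        = γ * ∑ i, π i * (P.mulVec v i * v i) - s := by
      rw [inner_sum, hs, sqNormD, Finset.mul_sum, ← Finset.sum_sub_distrib]
      refine Finset.sum_congr rfl fun i _ => ?_
      rw [inner_smul_right, real_inner_comm, hw]
      ring
    rw [h]
    nlinarith
  have hw₁ : sqNormD π w ≤ (1 + γ) ^ 2 * s := by
    have h : sqNormD π w = γ ^ 2 * sqNormD π (P.mulVec v)
        - 2 * γ * ∑ i, π i * (P.mulVec v i * v i) + s := by
      rw [hs, sqNormD, sqNormD, sqNormD, Finset.mul_sum, Finset.mul_sum, ← Finset.sum_sub_distrib,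
        ← Finset.sum_add_distrib]
      refine Finset.sum_congr rfl fun i _ => ?_
      rw [hw]
      ring
    rw [h]
    nlinarith [sq_nonneg γ]
  have hnorm : ‖∑ i, (π i * w i) • φ i‖ ^ 2 ≤ lambdaM π φ ^ 2 * ((1 + γ) ^ 2 * s) := by
    have h := pow_le_pow_left₀ (norm_nonneg _) (norm_sum_smul_le (φ := φ) hπ.nonneg w) 2
    rw [mul_pow, Real.sq_sqrt (sqNormD_nonneg hπ.nonneg w)] at h
    exact h.trans (mul_le_mul_of_nonneg_left hw₁ (sq_nonneg _))
  have hray := featureRayleigh_mul_le (φ := φ) hπ.nonneg u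
  have hpos := sub_pos.2 (lambdaM_sq_mul_lt hγ₀ hγ₁ hscale)
  have hsq : ‖u + ∑ i, (π i * w i) • φ i‖ ^ 2 ≤ (1 - featureRayleigh π φ *
      (2 * (1 - γ) - lambdaM π φ ^ 2 * (1 + γ) ^ 2)) * ‖u‖ ^ 2 := by
    rw [norm_add_sq_real]
    nlinarith [mul_le_mul_of_nonneg_right hray hpos.le]
  calc ‖u + ∑ i, (π i * w i) • φ i‖ = Real.sqrt (‖u + ∑ i, (π i * w i) • φ i‖ ^ 2) :=
        (Real.sqrt_sq (norm_nonneg _)).symm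
    _ ≤ _ := Real.sqrt_le_sqrt hsq
    _ = _ := by rw [Real.sqrt_mul' _ (sq_nonneg _), Real.sqrt_sq (norm_nonneg _)]

end Contraction

/-! ### Discounted sums -/

section Discounted

variable {E : Type*} [NormedAddCommGroup E] [NormedSpace ℝ E]

/-- The discounted sum `∑_{k < n} a k ∏_{k < l < n} (1 - a l) f k`, defined by the recursion
`w (n + 1) = (1 - a n) w n + a n f n` started at `0`. -/
noncomputable def discountedSum (a : ℕ → ℝ) (f : ℕ → E) : ℕ → E
  | 0 => 0
  | n + 1 => (1 - a n) • discountedSum a f n + a n • f n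

theorem norm_discountedSum_le {a : ℕ → ℝ} (ha₀ : ∀ k, 0 < a k) (ha₁ : ∀ k, a k < 1) {f : ℕ → E}
    {C : ℝ} (hC : 0 ≤ C) {n : ℕ} (hf : ∀ k < n, ‖f k‖ ≤ C) : ‖discountedSum a f n‖ ≤ C := by
  induction n with
  | zero => simpa [discountedSum] using hC
  | succ n ih =>
    have h₁ := ih fun k hk => hf k (by omega)
    have h₂ := hf n (by omega)
    have h₃ : 0 < 1 - a n := sub_pos.2 (ha₁ n)
    calc ‖discountedSum a f (n + 1)‖ ≤ (1 - a n) * ‖discountedSum a f n‖ + a n * ‖f n‖ := by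
          refine (norm_add_le _ _).trans_eq ?_
          rw [norm_smul_of_nonneg h₃.le, norm_smul_of_nonneg (ha₀ n).le]
      _ ≤ (1 - a n) * C + a n * C :=
          add_le_add (mul_le_mul_of_nonneg_left h₁ h₃.le)
            (mul_le_mul_of_nonneg_left h₂ (ha₀ n).le)
      _ = C := by ring

/-- Discounted summation by parts: if `s (k + 1)` is within `a k * C` of `t k`, then the discounted
sum of the differences `s k - t k` almost telescopes and is of the order of the first stepsize. -/
theorem norm_discountedSum_sub_le {a : ℕ → ℝ} (ha₀ : ∀ k, 0 < a k) (ha₁ : ∀ k, a k < 1)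
    (ha : Antitone a) {s t : ℕ → E} {C : ℝ} (hC : 0 ≤ C) {n : ℕ} (hs : ∀ k < n, ‖s k‖ ≤ C)
    (ht : ∀ k < n, ‖t k‖ ≤ C) (hst : ∀ k < n, ‖s (k + 1) - t k‖ ≤ a k * C) :
    ‖discountedSum a (fun k => s k - t k) n‖ ≤ 4 * (a 0 * C) := by
  rcases n with _ | n
  · simpa [discountedSum] using mul_nonneg (ha₀ 0).le hC
  -- Truncated subtraction makes `a (0 - 1) = a 0`.
  have key : ∀ m ≤ n + 1, ‖discountedSum a (fun k => s k - t k) m + a (m - 1) • s m‖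
      ≤ (3 * a 0 - a (m - 1)) * C := by
    intro m hm
    induction m with
    | zero =>
      have h := mul_le_mul_of_nonneg_left (hs 0 (by omega)) (ha₀ 0).le
      simp only [discountedSum, zero_add, Nat.zero_sub, norm_smul_of_nonneg (ha₀ 0).le]
      nlinarith [mul_nonneg (ha₀ 0).le hC]
    | succ m ih =>
      have h₁ := ih (by omega)
      have h₂ := hs m (by omega)
      have h₃ := hst m (by omega)
      have h₄ : 0 < 1 - a m := sub_pos.2 (ha₁ m)
      have h₅ : a m ≤ a (m - 1) := ha (Nat.sub_le m 1)
      have h₆ : a (m - 1) ≤ a 0 := ha (Nat.zero_le _)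
      have h₇ : discountedSum a (fun k => s k - t k) (m + 1) + a (m + 1 - 1) • s (m + 1)
          = (1 - a m) • (discountedSum a (fun k => s k - t k) m + a (m - 1) • s m)
            + (a m - (1 - a m) * a (m - 1)) • s m + a m • (s (m + 1) - t m) := by
        rw [discountedSum, Nat.add_sub_cancel]
        module
      have h₈ : |a m - (1 - a m) * a (m - 1)| ≤ a (m - 1) - a m + a m * a 0 := by
        have := mul_le_mul_of_nonneg_left h₆ (ha₀ m).le
        have := mul_pos (ha₀ m) (ha₀ (m - 1))
        rw [abs_le]
        constructor <;> nlinarith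
      rw [h₇, Nat.add_sub_cancel]
      calc _ ≤ (1 - a m) * ‖discountedSum a (fun k => s k - t k) m + a (m - 1) • s m‖
            + |a m - (1 - a m) * a (m - 1)| * ‖s m‖ + a m * ‖s (m + 1) - t m‖ := by
            refine norm_add₃_le.trans_eq ?_
            rw [norm_smul_of_nonneg h₄.le, norm_smul_of_nonneg (ha₀ m).le, norm_smul,
              Real.norm_eq_abs]
        _ ≤ (1 - a m) * ((3 * a 0 - a (m - 1)) * C) + (a (m - 1) - a m + a m * a 0) * C
            + a m * (a 0 * C) := by
            refine add_le_add (add_le_add (mul_le_mul_of_nonneg_left h₁ h₄.le)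
              (mul_le_mul h₈ h₂ (norm_nonneg _) ((abs_nonneg _).trans h₈)))
              (mul_le_mul_of_nonneg_left (h₃.trans ?_) (ha₀ m).le)
            exact mul_le_mul_of_nonneg_right (ha (Nat.zero_le m)) hC
        _ ≤ (3 * a 0 - a m) * C := by
            have : 0 ≤ a m * (a 0 - a (m - 1)) * C :=
              mul_nonneg (mul_nonneg (ha₀ m).le (sub_nonneg.2 h₆)) hC
            nlinarith
  have h₁ := key (n + 1) le_rfl
  have h₂ : ‖s (n + 1)‖ ≤ 2 * C := by
    have h := (norm_add_le (s (n + 1) - t n) (t n)).trans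
      (add_le_add (hst n (by omega)) (ht n (by omega)))
    rw [sub_add_cancel] at h
    nlinarith [ha₁ n]
  have h₃ : a n ≤ a 0 := ha (Nat.zero_le n)
  rw [Nat.add_sub_cancel] at h₁
  have h₄ := norm_sub_le
    (discountedSum a (fun k => s k - t k) (n + 1) + a n • s (n + 1)) (a n • s (n + 1))
  rw [add_sub_cancel_right, norm_smul_of_nonneg (ha₀ n).le] at h₄
  nlinarith [mul_le_mul_of_nonneg_left h₂ (ha₀ n).le, mul_le_mul_of_nonneg_right h₃ hC]

/-! ### Pathwise error bound -/

/-- The noiseless recursion `z (n + 1) = z n + a n (T (z n) - z n)` started at `z₀`. -/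
noncomputable def meanIterate (a : ℕ → ℝ) (T : E → E) (z₀ : E) : ℕ → E
  | 0 => z₀
  | n + 1 => meanIterate a T z₀ n + a n • (T (meanIterate a T z₀ n) - meanIterate a T z₀ n)

theorem norm_meanIterate_sub_le {a : ℕ → ℝ} (ha₀ : ∀ k, 0 < a k) (ha₁ : ∀ k, a k < 1) {T : E → E}
    {α : ℝ} (hT : ∀ x y, ‖T x - T y‖ ≤ α * ‖x - y‖) {p : E} (hp : T p = p) (z₀ : E) (n : ℕ) :
    ‖meanIterate a T z₀ n - p‖
      ≤ Real.exp (-(1 - α) * ∑ k ∈ Finset.range n, a k) * ‖z₀ - p‖ := by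
  induction n with
  | zero => simp [meanIterate]
  | succ n ih =>
    set z := meanIterate a T z₀ n with hz
    have h₁ : meanIterate a T z₀ (n + 1) - p = (1 - a n) • (z - p) + a n • (T z - T p) := by
      rw [meanIterate, ← hz, hp]
      module
    have h₂ : 0 < 1 - a n := sub_pos.2 (ha₁ n)
    have h₃ : 1 - a n + a n * α ≤ Real.exp (-(1 - α) * a n) := by
      have := Real.add_one_le_exp (-(1 - α) * a n)
      linarith
    calc ‖meanIterate a T z₀ (n + 1) - p‖ ≤ (1 - a n) * ‖z - p‖ + a n * ‖T z - T p‖ := by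
          rw [h₁]
          refine (norm_add_le _ _).trans_eq ?_
          rw [norm_smul_of_nonneg h₂.le, norm_smul_of_nonneg (ha₀ n).le]
      _ ≤ (1 - a n + a n * α) * ‖z - p‖ := by
          have := mul_le_mul_of_nonneg_left (hT z p) (ha₀ n).le
          linarith
      _ ≤ Real.exp (-(1 - α) * a n) * ‖z - p‖ := mul_le_mul_of_nonneg_right h₃ (norm_nonneg _)
      _ ≤ Real.exp (-(1 - α) * a n) *
            (Real.exp (-(1 - α) * ∑ k ∈ Finset.range n, a k) * ‖z₀ - p‖) :=
          mul_le_mul_of_nonneg_left ih (Real.exp_pos _).le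
      _ = _ := by
          rw [← mul_assoc, ← Real.exp_add, Finset.sum_range_succ]
          congr 2
          ring

/-- Pathwise error bound for a perturbed contractive iteration. The perturbation is the sum of a
noise `N k`, whose discounted sums are at most `δ`, and of a telescoping term
`v k (x k) - v (k + 1) (x k)`. The noise only needs to agree with `N` as long as the iterates stay
in the ball of radius `R` about the fixed point `p`; the error bound itself keeps them there. -/
theorem norm_sub_le_of_discountedSum_le {a : ℕ → ℝ} (ha₀ : ∀ k, 0 < a k) (ha₁ : ∀ k, a k < 1)
    (ha : Antitone a) {T : E → E} {α : ℝ} (hα₀ : 0 ≤ α)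
    (hT : ∀ x y, ‖T x - T y‖ ≤ α * ‖x - y‖) {p : E} (hp : T p = p)
    {v : ℕ → E → E} {A L : ℝ} (hA : 0 ≤ A) (hL : 0 ≤ L) (hv : ∀ k x, ‖v k x‖ ≤ A + L * ‖x - p‖)
    {x : ℕ → E} (hvx : ∀ k, ‖v (k + 1) (x (k + 1)) - v (k + 1) (x k)‖
      ≤ a k * (A + L * ‖x k - p‖))
    {N : ℕ → E} {R δ ε : ℝ} (hx : ∀ k, ‖x k - p‖ ≤ R →
      x (k + 1) = x k + a k • (T (x k) - x k + N k + v k (x k) - v (k + 1) (x k)))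
    (hδ : 0 ≤ δ) (hε : 0 ≤ ε) (hx₀ : ‖x 0 - p‖ ≤ ε) (hden : α + a 0 * (4 * L) < 1)
    (hR : ε + (a 0 * (4 * A + 4 * L * ε) + δ) / (1 - α - a 0 * (4 * L)) ≤ R)
    {m : ℕ} (hN : ∀ k ≤ m, ‖discountedSum a N k‖ ≤ δ) :
    ‖x m - p‖ ≤ Real.exp (-(1 - α) * ∑ k ∈ Finset.range m, a k) * ε
      + (a 0 * (4 * A + 4 * L * ε) + δ) / (1 - α - a 0 * (4 * L)) := by
  have ha0 := ha₀ 0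
  have hden' : 0 < 1 - α - a 0 * (4 * L) := by linarith
  set B := (a 0 * (4 * A + 4 * L * ε) + δ) / (1 - α - a 0 * (4 * L)) with hB
  have hB₀ : 0 ≤ B := by positivity
  have hBeq : α * B + δ + 4 * (a 0 * (A + L * (ε + B))) = B := by
    have : B * (1 - α - a 0 * (4 * L)) = a 0 * (4 * A + 4 * L * ε) + δ :=
      div_mul_cancel₀ _ hden'.ne'
    linarith
  have hα₁ : α < 1 := by nlinarith [mul_nonneg ha0.le hL]
  set z := meanIterate a T (x 0) with hz
  have hzbound : ∀ n, ‖z n - p‖ ≤ Real.exp (-(1 - α) * ∑ k ∈ Finset.range n, a k) * ε :=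
    fun n => (norm_meanIterate_sub_le ha₀ ha₁ hT hp (x 0) n).trans
      (mul_le_mul_of_nonneg_left hx₀ (Real.exp_pos _).le)
  have hzε : ∀ n, ‖z n - p‖ ≤ ε := by
    intro n
    refine (hzbound n).trans (mul_le_of_le_one_left hε (Real.exp_le_one_iff.2 ?_))
    have : 0 ≤ ∑ k ∈ Finset.range n, a k := Finset.sum_nonneg fun k _ => (ha₀ k).le
    nlinarith
  have hclose : ∀ n, ‖x n - z n‖ ≤ B → ‖x n - p‖ ≤ ε + B := by
    intro n hn
    have := norm_sub_le_norm_sub_add_norm_sub (x n) (z n) p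
    linarith [hzε n]
  have hmain : ∀ n ≤ m, ‖x n - z n‖ ≤ B := by
    intro n
    induction n using Nat.strong_induction_on with
    | _ n ih =>
      intro hn
      have hball : ∀ k < n, ‖x k - p‖ ≤ ε + B := fun k hk => hclose k (ih k hk (by omega))
      have hdec : ∀ k ≤ n, x k - z k = discountedSum a (fun l => T (x l) - T (z l)) k
          + discountedSum a N k + discountedSum a (fun l => v l (x l) - v (l + 1) (x l)) k := by
        intro k hk
        induction k with
        | zero => simp [discountedSum, hz, meanIterate]
        | succ k ihk =>
          have h₁ := ihk (by omega)
          have h₂ : z (k + 1) = z k + a k • (T (z k) - z k) := rfl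
          rw [hx k ((hball k (by omega)).trans hR), h₂, discountedSum, discountedSum,
            discountedSum]
          have h₃ : discountedSum a (fun l => T (x l) - T (z l)) k = x k - z k
              - discountedSum a N k
              - discountedSum a (fun l => v l (x l) - v (l + 1) (x l)) k := by
            rw [h₁]; abel
          rw [h₃]
          module
      have hC : 0 ≤ A + L * (ε + B) := by positivity
      have hlin : ∀ k < n, A + L * ‖x k - p‖ ≤ A + L * (ε + B) := fun k hk =>
        add_le_add le_rfl (mul_le_mul_of_nonneg_left (hball k hk) hL)
      have h₁ : ‖discountedSum a (fun l => T (x l) - T (z l)) n‖ ≤ α * B :=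
        norm_discountedSum_le ha₀ ha₁ (mul_nonneg hα₀ hB₀) fun k hk =>
          (hT _ _).trans (mul_le_mul_of_nonneg_left (ih k hk (by omega)) hα₀)
      have h₂ : ‖discountedSum a (fun l => v l (x l) - v (l + 1) (x l)) n‖
          ≤ 4 * (a 0 * (A + L * (ε + B))) :=
        norm_discountedSum_sub_le ha₀ ha₁ ha (s := fun l => v l (x l))
          (t := fun l => v (l + 1) (x l)) hC
          (fun k hk => (hv k (x k)).trans (hlin k hk))
          (fun k hk => (hv (k + 1) (x k)).trans (hlin k hk))
          (fun k hk => (hvx k).trans (mul_le_mul_of_nonneg_left (hlin k hk) (ha₀ k).le))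
      rw [hdec n le_rfl, ← hBeq]
      exact norm_add₃_le.trans (add_le_add (add_le_add h₁ (hN n hn)) h₂)
  have := norm_sub_le_norm_sub_add_norm_sub (x m) (z m) p
  linarith [hmain m le_rfl, hzbound m]

end Discounted

/-! ### Concentration of discounted martingale sums -/

/-- Hoeffding's lemma for a finitely supported law: a centred variable with values in `[-c, c]` is
sub-Gaussian with variance proxy `c ^ 2`. -/
theorem sum_mul_exp_le {S : Type*} [Fintype S] {p y : S → ℝ} (hp : ∀ j, 0 ≤ p j)
    (hp₁ : ∑ j, p j = 1) (hy : ∑ j, p j * y j = 0) {c : ℝ} (hc : 0 < c) (hyc : ∀ j, |y j| ≤ c)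
    (θ : ℝ) : ∑ j, p j * Real.exp (θ * y j) ≤ Real.exp (θ ^ 2 * c ^ 2 / 2) := by
  -- on `[-c, c]` the exponential lies below its chord
  have hchord : ∀ j, Real.exp (θ * y j)
      ≤ Real.cosh (θ * c) + y j * (Real.sinh (θ * c) / c) := by
    intro j
    obtain ⟨h₁, h₂⟩ := abs_le.1 (hyc j)
    have h := convexOn_exp.2 (Set.mem_univ (θ * c)) (Set.mem_univ (-(θ * c)))
      (show 0 ≤ (c + y j) / (2 * c) from div_nonneg (by linarith) (by linarith))
      (show 0 ≤ (c - y j) / (2 * c) from div_nonneg (by linarith) (by linarith))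
      (by field_simp; ring)
    simp only [smul_eq_mul] at h
    have h₃ : (c + y j) / (2 * c) * (θ * c) + (c - y j) / (2 * c) * -(θ * c) = θ * y j := by
      field_simp
      ring
    rw [h₃] at h
    refine h.trans_eq ?_
    rw [Real.cosh_eq, Real.sinh_eq]
    field_simp
    ring
  calc ∑ j, p j * Real.exp (θ * y j)
      ≤ ∑ j, p j * (Real.cosh (θ * c) + y j * (Real.sinh (θ * c) / c)) :=
        Finset.sum_le_sum fun j _ => mul_le_mul_of_nonneg_left (hchord j) (hp j)
    _ = (∑ j, p j) * Real.cosh (θ * c) + (∑ j, p j * y j) * (Real.sinh (θ * c) / c) := by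
        rw [Finset.sum_mul, Finset.sum_mul, ← Finset.sum_add_distrib]
        exact Finset.sum_congr rfl fun j _ => by ring
    _ = Real.cosh (θ * c) := by rw [hp₁, hy]; ring
    _ ≤ Real.exp ((θ * c) ^ 2 / 2) := Real.cosh_le_exp_half_sq _
    _ = _ := by rw [mul_pow]

/-- The sum of the squared weights of `discountedSum a`. -/
noncomputable def discountedVariance (a : ℕ → ℝ) : ℕ → ℝ
  | 0 => 0
  | n + 1 => (1 - a n) ^ 2 * discountedVariance a n + a n ^ 2

theorem discountedVariance_nonneg (a : ℕ → ℝ) (n : ℕ) : 0 ≤ discountedVariance a n := by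
  induction n with
  | zero => exact le_rfl
  | succ n ih =>
    rw [discountedVariance]
    positivity

section Markov

variable {S Ω : Type*} [MeasurableSpace S] {d : ℕ}
  {x₀ : Ω → EuclideanSpace ℝ (Fin d)} {Y : ℕ → Ω → S}

theorem history_mono : Monotone (history x₀ Y) := fun _ _ h =>
  sup_le_sup le_rfl (biSup_mono fun _ hk => hk.trans h)

theorem measurable_history_state {k n : ℕ} (h : k ≤ n) : Measurable[history x₀ Y n] (Y k) :=
  measurable_iff_comap_le.2 (le_sup_of_le_right
    (le_iSup₂ (f := fun k _ => MeasurableSpace.comap (Y k) inferInstance) k h))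

theorem measurable_history_init (n : ℕ) : Measurable[history x₀ Y n] x₀ :=
  measurable_iff_comap_le.2 le_sup_left

variable [MeasurableSpace Ω] {P : Matrix S S ℝ} {μ : Measure Ω}

theorem IsMarkovChain.history_le (hM : IsMarkovChain P μ x₀ Y) (n : ℕ) :
    history x₀ Y n ≤ (inferInstance : MeasurableSpace Ω) :=
  sup_le hM.measurable_init.comap_le (iSup₂_le fun k _ => (hM.measurable_state k).comap_le)

variable [Fintype S] [MeasurableSingletonClass S] [IsProbabilityMeasure μ]

/-- The Markov property for bounded functions of the past and of the next state. -/
theorem IsMarkovChain.integral_next (hM : IsMarkovChain P μ x₀ Y) (n : ℕ) {f : Ω → S → ℝ}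
    (hf : ∀ j, Measurable[history x₀ Y n] fun ω => f ω j) {C : ℝ} (hC : ∀ ω j, |f ω j| ≤ C) :
    ∫ ω, f ω (Y (n + 1) ω) ∂μ = ∫ ω, ∑ j, P (Y n ω) j * f ω j ∂μ := by
  classical
  have hle := hM.history_le n
  have hset : ∀ j, MeasurableSet (Y (n + 1) ⁻¹' {j}) := fun j =>
    hM.measurable_state (n + 1) (measurableSet_singleton j)
  have hone : ∀ j, Integrable ((Y (n + 1) ⁻¹' {j}).indicator fun _ => (1 : ℝ)) μ := fun j =>
    (integrable_const 1).indicator (hset j)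
  have hfint : ∀ j, Integrable (fun ω => f ω j) μ := fun j =>
    Integrable.of_bound ((hf j).mono hle le_rfl).aestronglyMeasurable C
      (Filter.Eventually.of_forall fun ω => hC ω j)
  have hprod : ∀ j, Integrable (fun ω => f ω j *
      (Y (n + 1) ⁻¹' {j}).indicator (fun _ => (1 : ℝ)) ω) μ := fun j =>
    (hone j).bdd_mul ((hf j).mono hle le_rfl).aestronglyMeasurable
      (Filter.Eventually.of_forall fun ω => hC ω j)
  have hcond : ∀ j, (fun ω => P (Y n ω) j * f ω j) =ᵐ[μ]
      μ[fun ω => f ω j * (Y (n + 1) ⁻¹' {j}).indicator (fun _ => (1 : ℝ)) ω | history x₀ Y n] := by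
    intro j
    have h := condExp_mul_of_stronglyMeasurable_left (μ := μ) (hf j).stronglyMeasurable (hprod j)
      (hone j)
    filter_upwards [h, hM.transition n j] with ω h₁ h₂
    refine Eq.trans ?_ h₁.symm
    rw [Pi.mul_apply, h₂, mul_comm]
  calc ∫ ω, f ω (Y (n + 1) ω) ∂μ
      = ∫ ω, ∑ j, f ω j * (Y (n + 1) ⁻¹' {j}).indicator (fun _ => (1 : ℝ)) ω ∂μ := by
        congr 1
        ext ω
        rw [Finset.sum_eq_single (Y (n + 1) ω)]
        · simp
        · intro j _ hj
          simp [hj.symm]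
        · simp
    _ = ∑ j, ∫ ω, P (Y n ω) j * f ω j ∂μ := by
        rw [integral_finsetSum _ fun j _ => hprod j]
        refine Finset.sum_congr rfl fun j _ => ?_
        rw [integral_congr_ae (hcond j), integral_condExp hle]
    _ = _ := by
        rw [integral_finsetSum]
        exact fun j _ => integrable_condExp.congr (hcond j).symm

/-- Azuma's inequality in exponential form for the discounted sum, from time `n₀` on, of bounded
martingale differences `ξ k ω (Y (k + 1) ω)` of the chain. -/
theorem IsMarkovChain.hasSubgaussianMGF_discountedSum [DecidableEq S]
    (hM : IsMarkovChain P μ x₀ Y)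
    (hP : P ∈ Matrix.rowStochastic ℝ S) {a : ℕ → ℝ} (ha₀ : ∀ k, 0 < a k) (ha₁ : ∀ k, a k < 1)
    (n₀ : ℕ) {ξ : ℕ → Ω → S → ℝ}
    (hξ : ∀ k j, Measurable[history x₀ Y (n₀ + k)] fun ω => ξ k ω j)
    (hmean : ∀ k ω, ∑ j, P (Y (n₀ + k) ω) j * ξ k ω j = 0) {c : ℝ} (hc : 0 < c)
    (hξc : ∀ k ω j, |ξ k ω j| ≤ c) (n : ℕ) :
    ProbabilityTheory.HasSubgaussianMGF
      (fun ω => discountedSum a (fun k => ξ k ω (Y (n₀ + k + 1) ω)) n)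
      ⟨c ^ 2 * discountedVariance a n, mul_nonneg (sq_nonneg c) (discountedVariance_nonneg a n)⟩
      μ := by
  set W : ℕ → Ω → ℝ := fun n ω => discountedSum a (fun k => ξ k ω (Y (n₀ + k + 1) ω)) n with hW
  have hWbound : ∀ n ω, |W n ω| ≤ c := fun n ω =>
    norm_discountedSum_le (f := fun k => ξ k ω (Y (n₀ + k + 1) ω)) ha₀ ha₁ hc.le
      fun k _ => hξc k ω _
  have hξmeas : ∀ k, Measurable[history x₀ Y (n₀ + k + 1)]
      fun ω => ξ k ω (Y (n₀ + k + 1) ω) := by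
    intro k
    have h : Measurable[(history x₀ Y (n₀ + k + 1)).prod inferInstance]
        fun q : Ω × S => ξ k q.1 q.2 :=
      @measurable_from_prod_countable_left _ _ _ (history x₀ Y (n₀ + k + 1)) _ _ _ _ _ fun j =>
        (hξ k j).mono (history_mono (Nat.le_succ _)) le_rfl
    exact h.comp (Measurable.prodMk (@measurable_id _ (history x₀ Y (n₀ + k + 1)))
      (measurable_history_state le_rfl))
  have hWmeas : ∀ n, Measurable[history x₀ Y (n₀ + n)] (W n) := by
    intro n
    induction n with
    | zero => exact measurable_const
    | succ n ih =>
      exact ((ih.mono (history_mono (Nat.le_succ _)) le_rfl).const_smul (1 - a n)).add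
        ((hξmeas n).const_smul (a n))
  have hint : ∀ n θ, Integrable (fun ω => Real.exp (θ * W n ω)) μ := by
    intro n θ
    refine Integrable.of_bound (C := Real.exp (|θ| * c)) ?_
      (Filter.Eventually.of_forall fun ω => ?_)
    · exact (Real.measurable_exp.comp (((hWmeas n).mono (hM.history_le _) le_rfl).const_mul
        θ)).aestronglyMeasurable
    · rw [Real.norm_eq_abs, Real.abs_exp, Real.exp_le_exp]
      refine (le_abs_self _).trans ?_
      rw [abs_mul]
      exact mul_le_mul_of_nonneg_left (hWbound n ω) (abs_nonneg θ)
  refine ⟨hint n, ?_⟩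
  suffices h : ∀ n θ, ∫ ω, Real.exp (θ * W n ω) ∂μ
      ≤ Real.exp (c ^ 2 * discountedVariance a n * θ ^ 2 / 2) from fun θ => h n θ
  intro n
  induction n with
  | zero => intro θ; simp [hW, discountedSum, discountedVariance]
  | succ n ih =>
    intro θ
    set f : Ω → S → ℝ := fun ω j =>
      Real.exp (θ * (1 - a n) * W n ω) * Real.exp (θ * a n * ξ n ω j) with hf
    have hfmeas : ∀ j, Measurable[history x₀ Y (n₀ + n)] fun ω => f ω j := fun j =>
      (Real.measurable_exp.comp ((hWmeas n).const_mul _)).mul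
        (Real.measurable_exp.comp ((hξ n j).const_mul _))
    have hfbound : ∀ ω j,
        |f ω j| ≤ Real.exp (|θ * (1 - a n)| * c) * Real.exp (|θ * a n| * c) := by
      intro ω j
      rw [hf, abs_mul, Real.abs_exp, Real.abs_exp]
      refine mul_le_mul (Real.exp_le_exp.2 ?_) (Real.exp_le_exp.2 ?_) (Real.exp_pos _).le
        (Real.exp_pos _).le
      · refine (le_abs_self _).trans ?_
        rw [abs_mul]
        exact mul_le_mul_of_nonneg_left (hWbound n ω) (abs_nonneg _)
      · refine (le_abs_self _).trans ?_
        rw [abs_mul]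
        exact mul_le_mul_of_nonneg_left (hξc n ω j) (abs_nonneg _)
    have hstep : ∫ ω, Real.exp (θ * W (n + 1) ω) ∂μ = ∫ ω, f ω (Y (n₀ + n + 1) ω) ∂μ := by
      congr 1
      ext ω
      simp only [hf, ← Real.exp_add]
      congr 1
      simp only [hW, discountedSum, smul_eq_mul]
      ring
    have hle : ∀ ω, ∑ j, P (Y (n₀ + n) ω) j * f ω j
        ≤ Real.exp (θ * (1 - a n) * W n ω) * Real.exp ((θ * a n) ^ 2 * c ^ 2 / 2) := by
      intro ω
      have h := sum_mul_exp_le (p := P (Y (n₀ + n) ω)) (y := ξ n ω)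
        (fun j => Matrix.nonneg_of_mem_rowStochastic hP)
        (Matrix.sum_row_of_mem_rowStochastic hP _) (hmean n ω) hc (hξc n ω) (θ * a n)
      refine le_trans (le_of_eq ?_) (mul_le_mul_of_nonneg_left h (Real.exp_pos _).le)
      rw [Finset.mul_sum]
      exact Finset.sum_congr rfl fun j _ => by rw [hf]; ring
    rw [hstep, hM.integral_next (n₀ + n) hfmeas hfbound]
    calc ∫ ω, ∑ j, P (Y (n₀ + n) ω) j * f ω j ∂μ
        ≤ ∫ ω, Real.exp (θ * (1 - a n) * W n ω) * Real.exp ((θ * a n) ^ 2 * c ^ 2 / 2) ∂μ := by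
          refine integral_mono_of_nonneg (Filter.Eventually.of_forall fun ω => ?_)
            ((hint n _).mul_const _) (Filter.Eventually.of_forall hle)
          exact Finset.sum_nonneg fun j _ => mul_nonneg (Matrix.nonneg_of_mem_rowStochastic hP)
            (mul_pos (Real.exp_pos _) (Real.exp_pos _)).le
      _ ≤ Real.exp (c ^ 2 * discountedVariance a n * (θ * (1 - a n)) ^ 2 / 2)
            * Real.exp ((θ * a n) ^ 2 * c ^ 2 / 2) := by
          rw [integral_mul_const]
          exact mul_le_mul_of_nonneg_right (ih _) (Real.exp_pos _).le
      _ = _ := by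
          rw [← Real.exp_add, discountedVariance]
          congr 1
          ring

/-- Azuma's inequality for vector-valued martingale differences, coordinate by coordinate. -/
theorem IsMarkovChain.measure_norm_discountedSum_le [DecidableEq S]
    (hM : IsMarkovChain P μ x₀ Y) (hd : 1 ≤ d)
    (hP : P ∈ Matrix.rowStochastic ℝ S) {a : ℕ → ℝ} (ha₀ : ∀ k, 0 < a k) (ha₁ : ∀ k, a k < 1)
    (n₀ : ℕ) {ξ : ℕ → Ω → S → EuclideanSpace ℝ (Fin d)}
    (hξ : ∀ k j, Measurable[history x₀ Y (n₀ + k)] fun ω => ξ k ω j)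
    (hmean : ∀ k ω, ∑ j, P (Y (n₀ + k) ω) j • ξ k ω j = 0) {c : ℝ} (hc : 0 < c)
    (hξc : ∀ k ω j, ‖ξ k ω j‖ ≤ c) (n : ℕ) {σ : ℝ} (hσ : 0 < σ)
    (hσn : discountedVariance a n ≤ σ) {δ : ℝ} (hδ : 0 < δ) :
    μ.real {ω | δ < ‖discountedSum a (fun k => ξ k ω (Y (n₀ + k + 1) ω)) n‖}
      ≤ 2 * d * Real.exp (-δ ^ 2 / (2 * d * c ^ 2 * σ)) := by
  have hd' : (0 : ℝ) < d := by exact_mod_cast hd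
  set W : Ω → EuclideanSpace ℝ (Fin d) :=
    fun ω => discountedSum a (fun k => ξ k ω (Y (n₀ + k + 1) ω)) n with hW
  set t := δ / Real.sqrt d with ht
  have ht₀ : 0 ≤ t := by positivity
  have ht₂ : t ^ 2 = δ ^ 2 / d := by rw [ht, div_pow, Real.sq_sqrt hd'.le]
  have hcoord : ∀ l ω, W ω l
      = discountedSum a (fun k => ξ k ω (Y (n₀ + k + 1) ω) l) n := by
    intro l ω
    rw [hW]
    clear hσn
    induction n with
    | zero => simp [discountedSum]
    | succ n ih =>
      simp only [discountedSum, smul_eq_mul, ← ih]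
      simp
  set s : NNReal := ⟨c ^ 2 * σ, by positivity⟩ with hs
  have hsub : ∀ l, ProbabilityTheory.HasSubgaussianMGF (fun ω => W ω l) s μ := by
    intro l
    have h : ProbabilityTheory.HasSubgaussianMGF (fun ω => W ω l) ⟨c ^ 2 * discountedVariance a n,
        mul_nonneg (sq_nonneg c) (discountedVariance_nonneg a n)⟩ μ := by
      simp only [hcoord]
      refine hM.hasSubgaussianMGF_discountedSum hP ha₀ ha₁ n₀ (ξ := fun k ω j => ξ k ω j l)
        (fun k j => ?_) (fun k ω => ?_) hc (fun k ω j => ?_) n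
      · have h : Measurable fun v : EuclideanSpace ℝ (Fin d) => v l := by fun_prop
        exact h.comp (hξ k j)
      · have h := congrArg (fun v : EuclideanSpace ℝ (Fin d) => v l) (hmean k ω)
        simpa using h
      · exact (PiLp.norm_apply_le (ξ k ω j) l).trans (hξc k ω j)
    refine ⟨h.integrable_exp_mul, fun θ => (h.mgf_le θ).trans (Real.exp_le_exp.2 ?_)⟩
    have h₁ : c ^ 2 * discountedVariance a n ≤ c ^ 2 * σ :=
      mul_le_mul_of_nonneg_left hσn (sq_nonneg c)
    have h₂ := mul_le_mul_of_nonneg_right h₁ (sq_nonneg θ)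
    change c ^ 2 * discountedVariance a n * θ ^ 2 / 2 ≤ c ^ 2 * σ * θ ^ 2 / 2
    linarith
  have htail : ∀ l, μ.real ({ω | t ≤ W ω l} ∪ {ω | t ≤ -W ω l})
      ≤ 2 * Real.exp (-δ ^ 2 / (2 * d * c ^ 2 * σ)) := by
    intro l
    have h : Real.exp (-t ^ 2 / (2 * (s : ℝ))) = Real.exp (-δ ^ 2 / (2 * d * c ^ 2 * σ)) := by
      congr 1
      change -t ^ 2 / (2 * (c ^ 2 * σ)) = _
      rw [ht₂]
      field_simp
    have h₁ := (hsub l).measure_ge_le ht₀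
    have h₂ := (hsub l).neg.measure_ge_le ht₀
    rw [h] at h₁ h₂
    refine (measureReal_union_le _ _).trans ?_
    rw [two_mul]
    exact add_le_add h₁ h₂
  have hcover : {ω | δ < ‖W ω‖} ⊆ ⋃ l ∈ (Finset.univ : Finset (Fin d)),
      ({ω | t ≤ W ω l} ∪ {ω | t ≤ -W ω l}) := by
    intro ω hω
    by_contra hcon
    simp only [Finset.mem_univ, Set.iUnion_true, Set.mem_iUnion, Set.mem_union, Set.mem_ofPred_eq,
      not_exists, not_or, not_le] at hcon
    have h₁ : ‖W ω‖ ^ 2 ≤ δ ^ 2 := by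
      rw [EuclideanSpace.norm_sq_eq]
      calc ∑ l, ‖W ω l‖ ^ 2 ≤ ∑ _l : Fin d, t ^ 2 := Finset.sum_le_sum fun l _ => by
            refine pow_le_pow_left₀ (norm_nonneg _) ?_ 2
            rw [Real.norm_eq_abs, abs_le]
            exact ⟨by linarith [(hcon l).2], (hcon l).1.le⟩
        _ = δ ^ 2 := by
            rw [Finset.sum_const, Finset.card_univ, Fintype.card_fin, nsmul_eq_mul, ht₂]
            field_simp
    exact absurd (le_of_sq_le_sq h₁ hδ.le) (not_le.2 hω)
  calc μ.real {ω | δ < ‖W ω‖} ≤ _ := measureReal_mono hcover (measure_ne_top _ _)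
    _ ≤ ∑ l : Fin d, μ.real ({ω | t ≤ W ω l} ∪ {ω | t ≤ -W ω l}) :=
        measureReal_biUnion_finset_le _ _
    _ ≤ ∑ _l : Fin d, 2 * Real.exp (-δ ^ 2 / (2 * d * c ^ 2 * σ)) :=
        Finset.sum_le_sum fun l _ => htail l
    _ = _ := by
        rw [Finset.sum_const, Finset.card_univ, Fintype.card_fin, nsmul_eq_mul]
        ring

end Markov

/-! ### Decay of the variance and of the tail series -/

section Stepsize

variable {a : ℕ → ℝ} {d₁ d₂ d₃ : ℝ}

theorem IsStepsize.pos (ha : IsStepsize a d₁ d₂ d₃) (n : ℕ) : 0 < a n :=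
  (div_pos ha.d₁_pos (by positivity)).trans_le (ha.lower n)

theorem IsStepsize.d₃_pos (ha : IsStepsize a d₁ d₂ d₃) : 0 < d₃ := by
  have h := (ha.pos 0).trans_le (ha.upper 0)
  simpa using h

/-- Both cases of `β` are governed by the exponent `min d₁ d₂`. -/
theorem beta_eq {k n : ℕ} (hk : 0 < k) : beta d₁ d₂ k n
    = (k : ℝ) ^ (min d₁ d₂ - d₂) * (n : ℝ) ^ (-min d₁ d₂) := by
  rw [beta]
  have hk' : (0 : ℝ) < k := by exact_mod_cast hk
  split_ifs with h
  · rw [min_eq_left h, one_div, mul_inv, ← Real.rpow_neg hk'.le, ← Real.rpow_neg n.cast_nonneg,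
      neg_sub]
  · rw [min_eq_right (not_le.1 h).le, sub_self, Real.rpow_zero, one_mul, one_div,
      Real.rpow_neg n.cast_nonneg]

theorem beta_pos {k n : ℕ} (hk : 0 < k) (hn : 0 < n) : 0 < beta d₁ d₂ k n := by
  have hk' : (0 : ℝ) < k := by exact_mod_cast hk
  have hn' : (0 : ℝ) < n := by exact_mod_cast hn
  rw [beta_eq hk]
  positivity

/-- A sequence `B` with `(1 - a n) B n ≤ B (n + 1)` and `a n ≤ B (n + 1)` dominates the discounted
variance, as `(1 - a) ^ 2 B n + a ^ 2 ≤ (1 - a) B (n + 1) + a B (n + 1)`. -/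
theorem discountedVariance_le_of_step {a B : ℕ → ℝ} (ha₀ : ∀ n, 0 < a n) (ha₁ : ∀ n, a n < 1)
    (hB₀ : 0 ≤ B 0) (hB : ∀ n, (1 - a n) * B n ≤ B (n + 1)) (haB : ∀ n, a n ≤ B (n + 1)) (n : ℕ) :
    discountedVariance a n ≤ B n := by
  induction n with
  | zero => exact hB₀
  | succ n ih =>
    have h : 0 < 1 - a n := sub_pos.2 (ha₁ n)
    have h₁ := mul_le_mul_of_nonneg_left (mul_le_mul_of_nonneg_left ih h.le) h.le
    have h₂ := mul_le_mul_of_nonneg_left (hB n) h.le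
    have h₃ := mul_le_mul_of_nonneg_left (haB n) (ha₀ n).le
    rw [discountedVariance]
    linarith

theorem IsStepsize.discountedVariance_le (ha : IsStepsize a d₁ d₂ d₃) {n₀ : ℕ} (hn₀ : 0 < n₀)
    (k : ℕ) : discountedVariance (fun l => a (n₀ + l)) k
      ≤ d₃ * 2 ^ min d₁ d₂ * beta d₁ d₂ n₀ (n₀ + k) := by
  set e := min d₁ d₂ with he
  have he₀ : 0 < e := lt_min ha.d₁_pos ha.d₂_pos
  have hed₁ : e ≤ d₁ := min_le_left _ _
  have hed₂ : e ≤ d₂ := min_le_right _ _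
  have hn₀' : (0 : ℝ) < n₀ := by exact_mod_cast hn₀
  have hK : 0 < d₃ * 2 ^ e * (n₀ : ℝ) ^ (e - d₂) := by
    have := ha.d₃_pos
    positivity
  -- the shift of `n₀ + l` by one makes `(1 - a) B ≤ B` follow from `1 + t ≤ exp t`
  have hstep := discountedVariance_le_of_step (a := fun l => a (n₀ + l))
    (B := fun l => d₃ * 2 ^ e * (n₀ : ℝ) ^ (e - d₂) * ((n₀ + l : ℕ) + 1 : ℝ) ^ (-e))
    (fun l => ha.pos _) (fun l => ha.lt_one _) (by positivity) (fun l => ?_) (fun l => ?_) k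
  · refine hstep.trans ?_
    rw [beta_eq hn₀, ← he]
    have hpos : (0 : ℝ) < (n₀ + k : ℕ) := by exact_mod_cast (by omega : 0 < n₀ + k)
    have h : ((n₀ + k : ℕ) + 1 : ℝ) ^ (-e) ≤ ((n₀ + k : ℕ) : ℝ) ^ (-e) :=
      Real.rpow_le_rpow_of_nonpos hpos (by linarith) (by linarith)
    calc _ ≤ d₃ * 2 ^ e * (n₀ : ℝ) ^ (e - d₂) * ((n₀ + k : ℕ) : ℝ) ^ (-e) :=
          mul_le_mul_of_nonneg_left h hK.le
      _ = _ := by ring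
  · set t : ℝ := ((n₀ + l : ℕ) : ℝ) + 1 with ht
    have ht₀ : 0 < t := by positivity
    have hcast : (((n₀ + (l + 1) : ℕ) : ℝ) + 1) = t + 1 := by rw [ht]; push_cast; ring
    rw [hcast]
    have h₁ : 1 - a (n₀ + l) ≤ Real.exp (-(e / t)) := by
      have h₂ := Real.add_one_le_exp (-(e / t))
      have h₃ := ha.lower (n₀ + l)
      have h₄ : e / t ≤ d₁ / t := div_le_div_of_nonneg_right hed₁ ht₀.le
      rw [← ht] at h₃
      linarith
    have h₂ : (t + 1) ^ e ≤ t ^ e * Real.exp (e / t) := by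
      have h₃ : t + 1 ≤ t * Real.exp (1 / t) := by
        have := mul_le_mul_of_nonneg_left (Real.add_one_le_exp (1 / t)) ht₀.le
        rwa [mul_add, mul_one_div_cancel ht₀.ne', mul_one, add_comm] at this
      refine (Real.rpow_le_rpow (by positivity) h₃ he₀.le).trans_eq ?_
      rw [Real.mul_rpow ht₀.le (Real.exp_pos _).le, ← Real.exp_mul]
      congr 2
      ring
    have h₃ : Real.exp (-(e / t)) * t ^ (-e) ≤ (t + 1) ^ (-e) := by
      rw [Real.exp_neg, Real.rpow_neg ht₀.le, Real.rpow_neg (by positivity), ← mul_inv, mul_comm]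
      exact inv_anti₀ (by positivity) h₂
    calc (1 - a (n₀ + l)) * (d₃ * 2 ^ e * (n₀ : ℝ) ^ (e - d₂) * t ^ (-e))
        ≤ Real.exp (-(e / t)) * (d₃ * 2 ^ e * (n₀ : ℝ) ^ (e - d₂) * t ^ (-e)) :=
          mul_le_mul_of_nonneg_right h₁ (by positivity)
      _ = d₃ * 2 ^ e * (n₀ : ℝ) ^ (e - d₂) * (Real.exp (-(e / t)) * t ^ (-e)) := by ring
      _ ≤ _ := mul_le_mul_of_nonneg_left h₃ hK.le
  · set t : ℝ := ((n₀ + l : ℕ) : ℝ) + 1 with ht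
    have hn₀t : (n₀ : ℝ) ≤ t := by
      rw [ht]
      push_cast
      linarith [(Nat.cast_nonneg l : (0 : ℝ) ≤ l)]
    have ht₁ : 1 ≤ t := by
      rw [ht]
      linarith [(Nat.cast_nonneg (n₀ + l) : (0 : ℝ) ≤ (n₀ + l : ℕ))]
    have ht₀ : 0 < t := by positivity
    have hcast : (((n₀ + (l + 1) : ℕ) : ℝ) + 1) = t + 1 := by rw [ht]; push_cast; ring
    rw [hcast]
    have h₁ : t ^ (e - d₂) ≤ (n₀ : ℝ) ^ (e - d₂) :=
      Real.rpow_le_rpow_of_nonpos hn₀' hn₀t (by linarith)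
    have h₂ : t ^ (-e) ≤ 2 ^ e * (t + 1) ^ (-e) := by
      have h : (t + 1) ^ e ≤ 2 ^ e * t ^ e := by
        rw [← Real.mul_rpow (by norm_num) ht₀.le]
        exact Real.rpow_le_rpow (by positivity) (by linarith) he₀.le
      have hp : 0 < (t + 1) ^ e := by positivity
      have hq : 0 < t ^ e := by positivity
      rw [Real.rpow_neg ht₀.le, Real.rpow_neg (by positivity), ← div_eq_mul_inv, inv_eq_one_div,
        div_le_div_iff₀ hq hp]
      linarith
    calc a (n₀ + l) ≤ d₃ * (1 / t) ^ d₂ := ha.upper _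
      _ = d₃ * (t ^ (e - d₂) * t ^ (-e)) := by
          rw [← Real.rpow_add ht₀, one_div, Real.inv_rpow ht₀.le, ← Real.rpow_neg ht₀.le]
          congr 2
          ring
      _ ≤ d₃ * ((n₀ : ℝ) ^ (e - d₂) * (2 ^ e * (t + 1) ^ (-e))) :=
          mul_le_mul_of_nonneg_left (mul_le_mul h₁ h₂ (by positivity) (by positivity))
            ha.d₃_pos.le
      _ = _ := by ring

theorem summable_exp_neg_mul_rpow {c e : ℝ} (hc : 0 < c) (he : 0 < e) :
    Summable fun n : ℕ => Real.exp (-c * (n : ℝ) ^ e) := by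
  have h := (isLittleO_exp_neg_mul_rpow_atTop hc (-(2 / e))).comp_tendsto
    ((tendsto_rpow_atTop he).comp tendsto_natCast_atTop_atTop)
  refine summable_of_isBigO_nat (Real.summable_nat_rpow_inv.2 one_lt_two) (h.isBigO.congr_right ?_)
  intro n
  simp only [Function.comp_apply]
  rw [← Real.rpow_mul n.cast_nonneg, ← Real.rpow_neg n.cast_nonneg]
  congr 1
  field_simp

theorem summable_exp_div_beta (hd₁ : 0 < d₁) (hd₂ : 0 < d₂) {D δ : ℝ} (hD : 0 < D) (hδ : 0 < δ)
    {n₀ : ℕ} (hn₀ : 0 < n₀) :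
    Summable fun k : ℕ => Real.exp (-D * δ ^ 2 / beta d₁ d₂ n₀ (n₀ + 1 + k)) := by
  have hn₀' : (0 : ℝ) < n₀ := by exact_mod_cast hn₀
  have hp : 0 < (n₀ : ℝ) ^ (min d₁ d₂ - d₂) := by positivity
  have h := (summable_nat_add_iff (n₀ + 1)).2 (summable_exp_neg_mul_rpow
    (c := D * δ ^ 2 / (n₀ : ℝ) ^ (min d₁ d₂ - d₂)) (by positivity) (lt_min hd₁ hd₂))
  refine h.congr fun k => ?_
  rw [beta_eq hn₀, Real.rpow_neg (Nat.cast_nonneg _), add_comm k]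
  congr 1
  field_simp

end Stepsize

/-! ### Union bounds -/

section UnionBound

variable {Ω : Type*} [MeasurableSpace Ω] {μ : Measure Ω} [IsProbabilityMeasure μ] {A B : Set Ω}

theorem one_sub_sum_le_measureReal {ι : Type*} {s : Finset ι} {C : ι → Set Ω} {u : ι → ℝ}
    (hcover : ∀ ω, ω ∉ B → (∀ i ∈ s, ω ∉ C i) → ω ∈ A) (hu : ∀ i ∈ s, μ.real (C i) ≤ u i) :
    1 - ∑ i ∈ s, u i - μ.real B ≤ μ.real A := by
  have h₁ : (Set.univ : Set Ω) ⊆ A ∪ (B ∪ ⋃ i ∈ s, C i) := by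
    intro ω _
    by_contra h
    simp only [Set.mem_union, Set.mem_iUnion, not_or, not_exists] at h
    exact h.1 (hcover ω h.2.1 h.2.2)
  have h₂ := measureReal_mono h₁ (measure_ne_top μ _)
  rw [probReal_univ] at h₂
  have h₃ := measureReal_union_le (μ := μ) A (B ∪ ⋃ i ∈ s, C i)
  have h₄ := measureReal_union_le (μ := μ) B (⋃ i ∈ s, C i)
  have h₅ := measureReal_biUnion_finset_le (μ := μ) s C
  have h₆ := Finset.sum_le_sum hu
  linarith

theorem one_sub_tsum_le_measureReal {C : ℕ → Set Ω} {u : ℕ → ℝ} (hsum : Summable u)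
    (hcover : ∀ ω, ω ∉ B → (∀ i, ω ∉ C i) → ω ∈ A) (hu : ∀ i, μ.real (C i) ≤ u i) :
    1 - ∑' i, u i - μ.real B ≤ μ.real A := by
  have h₁ : μ.real (⋃ i, C i) ≤ ∑' i, u i := by
    have hu₀ : ∀ i, 0 ≤ u i := fun i => measureReal_nonneg.trans (hu i)
    refine ENNReal.toReal_le_of_le_ofReal (tsum_nonneg hu₀) ?_
    rw [ENNReal.ofReal_tsum_of_nonneg hu₀ hsum]
    refine (measure_iUnion_le C).trans (ENNReal.tsum_le_tsum fun i => ?_)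
    rw [ENNReal.le_ofReal_iff_toReal_le (measure_ne_top μ _) (hu₀ i)]
    exact hu i
  have h₂ := one_sub_sum_le_measureReal (μ := μ) (A := A) (B := B) (s := {()})
    (C := fun _ => ⋃ i, C i) (u := fun _ => ∑' i, u i)
    (fun ω hB hC => hcover ω hB (by simpa using hC)) (fun _ _ => h₁)
  simpa using h₂

end UnionBound

/-! ### Poisson decomposition of the temporal difference increments -/

section Decomposition

variable {S : Type*} [Fintype S] {d : ℕ}

/-- `V(x, i) = ∑ j, G i j F(x, j)`. For the fundamental matrix `G` it solves the Poisson equation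
`V(x, i) - ∑ j, p(j | i) V(x, j) = F(x, i) - ∑ j, π(j) F(x, j)`. -/
noncomputable def poissonSolution (G P : Matrix S S ℝ) (γ : ℝ) (r : S → ℝ)
    (φ : S → EuclideanSpace ℝ (Fin d)) (i : S) (x : EuclideanSpace ℝ (Fin d)) :
    EuclideanSpace ℝ (Fin d) :=
  ∑ j, G i j • driftF P γ r φ x j

/-- The increment `φ(i) (r(i) + γ φ(j)ᵀ x - φ(i)ᵀ x)` at `x` along the transition from
`i` to `j`. -/
noncomputable def tdIncrement (γ : ℝ) (r : S → ℝ) (φ : S → EuclideanSpace ℝ (Fin d))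
    (x : EuclideanSpace ℝ (Fin d)) (i j : S) : EuclideanSpace ℝ (Fin d) :=
  (r i + γ * inner ℝ (φ j) x - inner ℝ (φ i) x) • φ i

/-- The part `γ φ(i) φ(j)ᵀ x + V(x, j)` of the increment that depends on the next state `j`,
including the correction by the solution of the Poisson equation, minus its conditional mean. -/
noncomputable def tdNoise (G P : Matrix S S ℝ) (γ : ℝ) (r : S → ℝ)
    (φ : S → EuclideanSpace ℝ (Fin d)) (x : EuclideanSpace ℝ (Fin d)) (i j : S) :
    EuclideanSpace ℝ (Fin d) :=
  ((γ * inner ℝ (φ j) x) • φ i + poissonSolution G P γ r φ j x)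
    - ∑ k, P i k • ((γ * inner ℝ (φ k) x) • φ i + poissonSolution G P γ r φ k x)

variable {G P : Matrix S S ℝ} {π : S → ℝ} {γ : ℝ} {r : S → ℝ}
  {φ : S → EuclideanSpace ℝ (Fin d)}

theorem sum_smul_tdNoise (hP : ∀ i, ∑ j, P i j = 1) (x : EuclideanSpace ℝ (Fin d)) (i : S) :
    ∑ j, P i j • tdNoise G P γ r φ x i j = 0 := by
  simp only [tdNoise, smul_sub, Finset.sum_sub_distrib]
  rw [← Finset.sum_smul, hP, one_smul, sub_self]

theorem poissonSolution_sub_sum [DecidableEq S]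
    (hG : ∀ i k, G i k - ∑ j, P i j * G j k = (1 : Matrix S S ℝ) i k - π k)
    (i : S) (x : EuclideanSpace ℝ (Fin d)) :
    poissonSolution G P γ r φ i x - ∑ j, P i j • poissonSolution G P γ r φ j x
      = driftF P γ r φ x i - meanF P π γ r φ x := by
  calc _ = ∑ k, (G i k - ∑ j, P i j * G j k) • driftF P γ r φ x k := by
        simp only [poissonSolution, sub_smul, Finset.sum_sub_distrib, Finset.smul_sum,
          Finset.sum_smul, smul_smul]
        rw [Finset.sum_comm]
    _ = ∑ k, ((1 : Matrix S S ℝ) i k - π k) • driftF P γ r φ x k := by simp only [hG]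
    _ = _ := by
        simp only [sub_smul, Finset.sum_sub_distrib, Matrix.one_apply, ite_smul, one_smul,
          zero_smul, Finset.sum_ite_eq, Finset.mem_univ, if_true, meanF]

/-- Mean drift, plus martingale difference, plus a term that telescopes along the trajectory. -/
theorem tdIncrement_eq [DecidableEq S]
    (hG : ∀ i k, G i k - ∑ j, P i j * G j k = (1 : Matrix S S ℝ) i k - π k)
    (x : EuclideanSpace ℝ (Fin d)) (i j : S) :
    tdIncrement γ r φ x i j = meanF P π γ r φ x - x + tdNoise G P γ r φ x i j
      + poissonSolution G P γ r φ i x - poissonSolution G P γ r φ j x := by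
  have h := poissonSolution_sub_sum (γ := γ) (r := r) (φ := φ) hG i x
  have h₁ : ∑ k, P i k • ((γ * inner ℝ (φ k) x) • φ i + poissonSolution G P γ r φ k x)
      = (γ * ∑ k, P i k * inner ℝ (φ k) x) • φ i
        + ∑ k, P i k • poissonSolution G P γ r φ k x := by
    simp only [smul_add, Finset.sum_add_distrib]
    congr 1
    rw [Finset.mul_sum, Finset.sum_smul]
    refine Finset.sum_congr rfl fun k _ => ?_
    module
  have h₂ : poissonSolution G P γ r φ i x = ∑ k, P i k • poissonSolution G P γ r φ k x
      + driftF P γ r φ x i - meanF P π γ r φ x := by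
    rw [add_sub_assoc, ← h]
    abel
  rw [tdNoise, h₁, h₂, driftF, tdIncrement]
  module

theorem driftF_sub_driftF (x y : EuclideanSpace ℝ (Fin d)) (i : S) :
    driftF P γ r φ x i - driftF P γ r φ y i
      = (γ * ∑ j, P i j * inner ℝ (φ j) (x - y) - inner ℝ (φ i) (x - y)) • φ i + (x - y) := by
  simp only [driftF, inner_sub_right, mul_sub, Finset.sum_sub_distrib]
  module

theorem continuous_driftF (i : S) : Continuous fun x => driftF P γ r φ x i := by
  unfold driftF
  fun_prop

theorem continuous_tdNoise (i j : S) : Continuous fun x => tdNoise G P γ r φ x i j := by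
  have h := fun i => continuous_driftF (P := P) (γ := γ) (r := r) (φ := φ) i
  unfold tdNoise poissonSolution
  fun_prop

theorem exists_norm_tdNoise_le (p : EuclideanSpace ℝ (Fin d)) (R : ℝ) :
    ∃ c, 0 < c ∧ ∀ x, ‖x - p‖ ≤ R → ∀ i j, ‖tdNoise G P γ r φ x i j‖ ≤ c := by
  have h : ∀ q : S × S, ∃ c, ∀ x ∈ Metric.closedBall p R, ‖tdNoise G P γ r φ x q.1 q.2‖ ≤ c :=
    fun q => (isCompact_closedBall p R).exists_bound_of_continuousOn
      (continuous_tdNoise q.1 q.2).continuousOn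
  choose c hc using h
  obtain ⟨M, hM⟩ := Finite.exists_le c
  refine ⟨max M 1, by positivity, fun x hx i j => ?_⟩
  exact (hc (i, j) x (by rwa [mem_closedBall_iff_norm])).trans ((hM _).trans (le_max_left _ _))

theorem exists_lipschitz_poissonSolution : ∃ K, 0 ≤ K ∧ ∀ i x y,
    ‖poissonSolution G P γ r φ i x - poissonSolution G P γ r φ i y‖ ≤ K * ‖x - y‖ := by
  have h : ∀ i : S, ∃ M : EuclideanSpace ℝ (Fin d) →L[ℝ] EuclideanSpace ℝ (Fin d), ∀ x y,
      poissonSolution G P γ r φ i x - poissonSolution G P γ r φ i y = M (x - y) := by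
    intro i
    refine ⟨∑ j, G i j • ((γ • ∑ k, P j k • innerSL ℝ (φ k) - innerSL ℝ (φ j)).smulRight (φ j)
      + ContinuousLinearMap.id ℝ _), fun x y => ?_⟩
    rw [poissonSolution, poissonSolution, ← Finset.sum_sub_distrib]
    simp only [← smul_sub, driftF_sub_driftF]
    simp
  choose M hM using h
  obtain ⟨K, hK⟩ := Finite.exists_le fun i => ‖M i‖
  refine ⟨max K 0, le_max_right _ _, fun i x y => ?_⟩
  rw [hM]
  exact ((M i).le_opNorm _).trans
    (mul_le_mul_of_nonneg_right ((hK i).trans (le_max_left _ _)) (norm_nonneg _))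

theorem exists_norm_tdIncrement_le (hγ₀ : 0 < γ) (p : EuclideanSpace ℝ (Fin d)) :
    ∃ A L, 0 ≤ A ∧ 0 ≤ L ∧ ∀ x i j, ‖tdIncrement γ r φ x i j‖ ≤ A + L * ‖x - p‖ := by
  obtain ⟨A, hA⟩ := Finite.exists_le fun q : S × S => ‖tdIncrement γ r φ p q.1 q.2‖
  obtain ⟨M, hM⟩ := Finite.exists_le fun i => ‖φ i‖
  refine ⟨max A 0, (γ * max M 0 + max M 0) * max M 0, le_max_right _ _, by positivity,
    fun x i j => ?_⟩
  have hM' : ∀ i, ‖φ i‖ ≤ max M 0 := fun i => (hM i).trans (le_max_left _ _)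
  have h₁ : tdIncrement γ r φ x i j = tdIncrement γ r φ p i j
      + (γ * inner ℝ (φ j) (x - p) - inner ℝ (φ i) (x - p)) • φ i := by
    simp only [tdIncrement, inner_sub_right]
    module
  have h₂ : ∀ i, |inner ℝ (φ i) (x - p)| ≤ max M 0 * ‖x - p‖ := fun i =>
    (abs_real_inner_le_norm _ _).trans (mul_le_mul_of_nonneg_right (hM' i) (norm_nonneg _))
  rw [h₁]
  refine (norm_add_le _ _).trans (add_le_add ((hA (i, j)).trans (le_max_left _ _)) ?_)
  rw [norm_smul, Real.norm_eq_abs]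
  calc _ ≤ (γ * (max M 0 * ‖x - p‖) + max M 0 * ‖x - p‖) * max M 0 := by
        refine mul_le_mul ((abs_sub _ _).trans (add_le_add ?_ (h₂ i))) (hM' i) (norm_nonneg _)
          (by positivity)
        rw [abs_mul, abs_of_pos hγ₀]
        exact mul_le_mul_of_nonneg_left (h₂ j) hγ₀.le
    _ = _ := by ring

/-- The constants of the error bound: the Poisson solution, and its variation along one step of
length `s` of the algorithm, grow at most linearly. -/
theorem exists_growth_constants (hγ₀ : 0 < γ) (p : EuclideanSpace ℝ (Fin d)) :
    ∃ A L, 0 < A ∧ 0 < L ∧ (∀ i x, ‖poissonSolution G P γ r φ i x‖ ≤ A + L * ‖x - p‖) ∧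
      ∀ x i j k (s : ℝ), 0 ≤ s → ‖poissonSolution G P γ r φ k (x + s • tdIncrement γ r φ x i j)
        - poissonSolution G P γ r φ k x‖ ≤ s * (A + L * ‖x - p‖) := by
  obtain ⟨K, hK₀, hK⟩ := exists_lipschitz_poissonSolution (G := G) (P := P) (γ := γ) (r := r)
    (φ := φ)
  obtain ⟨A, L, hA, hL, hAL⟩ := exists_norm_tdIncrement_le (r := r) (φ := φ) hγ₀ p
  obtain ⟨V, hV⟩ := Finite.exists_le fun i => ‖poissonSolution G P γ r φ i p‖
  refine ⟨max V 0 + K * A + 1, K + K * L + 1, by positivity, by positivity, fun i x => ?_,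
    fun x i j k s hs => ?_⟩
  · have h₁ := norm_le_norm_add_norm_sub' (poissonSolution G P γ r φ i x)
      (poissonSolution G P γ r φ i p)
    have h₂ := hK i x p
    have h₃ := (hV i).trans (le_max_left V 0)
    have h₄ : 0 ≤ K * A := by positivity
    have h₅ : 0 ≤ (K * L + 1) * ‖x - p‖ := by positivity
    linarith
  · refine (hK k _ _).trans ?_
    rw [add_sub_cancel_left, norm_smul_of_nonneg hs]
    have h₁ := mul_le_mul_of_nonneg_left (hAL x i j) (mul_nonneg hK₀ hs)
    have h₂ : 0 ≤ s * (max V 0 + 1 + (K + 1) * ‖x - p‖) := by positivity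
    linarith

end Decomposition

/-! ### The TD(0) iterates -/

theorem measurable_comp_prod_countable {Ω E F S : Type*} [MeasurableSpace E] [MeasurableSpace F]
    [MeasurableSpace S] [Countable S] [MeasurableSingletonClass S] {m : MeasurableSpace Ω}
    {g : E → S → F} (hg : ∀ i, Measurable fun x => g x i) {f : Ω → E} (hf : Measurable f)
    {y : Ω → S} (hy : Measurable y) : Measurable fun ω => g (f ω) (y ω) := by
  have h : Measurable fun q : E × S => g q.1 q.2 :=
    measurable_from_prod_countable_left hg
  exact h.comp (hf.prodMk hy)

section Iterates

variable {S : Type*} {d : ℕ} {γ : ℝ} {r : S → ℝ} {φ : S → EuclideanSpace ℝ (Fin d)} {a : ℕ → ℝ}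

theorem iterate_succ (y : ℕ → S) (x₀ : EuclideanSpace ℝ (Fin d)) (n : ℕ) :
    iterate γ r φ a y x₀ (n + 1) = iterate γ r φ a y x₀ n
      + a n • tdIncrement γ r φ (iterate γ r φ a y x₀ n) (y n) (y (n + 1)) := by
  rw [tdIncrement, smul_smul, iterate]

theorem measurable_iterate [Finite S] [MeasurableSpace S] [MeasurableSingletonClass S]
    {Ω : Type*} {x₀ : Ω → EuclideanSpace ℝ (Fin d)} {Y : ℕ → Ω → S} (n : ℕ) :
    Measurable[history x₀ Y n] fun ω => iterate γ r φ a (fun k => Y k ω) (x₀ ω) n := by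
  induction n with
  | zero => exact measurable_history_init 0
  | succ n ih =>
    have hg : ∀ s : S × S,
        Measurable fun x => x + a n • tdIncrement γ r φ x s.1 s.2 := by
      intro s
      have hc : Continuous fun x => x + a n • tdIncrement γ r φ x s.1 s.2 := by
        unfold tdIncrement
        fun_prop
      exact hc.measurable
    simp only [iterate_succ]
    exact measurable_comp_prod_countable (y := fun ω => (Y n ω, Y (n + 1) ω)) hg
      (ih.mono (history_mono (Nat.le_succ n)) le_rfl)
      ((measurable_history_state (Nat.le_succ n)).prodMk (measurable_history_state le_rfl))

theorem bSum_eq_sum_range {n₀ : ℕ} (hn₀ : 0 < n₀) (k : ℕ) :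
    bSum a n₀ (n₀ + k - 1) = ∑ l ∈ Finset.range k, a (n₀ + l) := by
  have h : Finset.Icc n₀ (n₀ + k - 1) = Finset.Ico n₀ (n₀ + k) := by
    ext m
    simp only [Finset.mem_Icc, Finset.mem_Ico]
    omega
  rw [bSum, h, Finset.sum_Ico_eq_sum_range, Nat.add_sub_cancel_left]

variable [Fintype S] {G P : Matrix S S ℝ}

open Classical in
/-- The noise at `x`, set to zero outside the ball of radius `R` about `p`. -/
noncomputable def truncatedNoise (G P : Matrix S S ℝ) (γ : ℝ) (r : S → ℝ)
    (φ : S → EuclideanSpace ℝ (Fin d)) (p : EuclideanSpace ℝ (Fin d)) (R : ℝ)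
    (x : EuclideanSpace ℝ (Fin d)) (i j : S) : EuclideanSpace ℝ (Fin d) :=
  if ‖x - p‖ ≤ R then tdNoise G P γ r φ x i j else 0

theorem measurable_truncatedNoise (p : EuclideanSpace ℝ (Fin d)) (R : ℝ) (i j : S) :
    Measurable fun x => truncatedNoise G P γ r φ p R x i j :=
  Measurable.ite (measurableSet_le (by fun_prop) measurable_const)
    (continuous_tdNoise i j).measurable measurable_const

theorem sum_smul_truncatedNoise (hP : ∀ i, ∑ j, P i j = 1) (p : EuclideanSpace ℝ (Fin d)) (R : ℝ)
    (x : EuclideanSpace ℝ (Fin d)) (i : S) :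
    ∑ j, P i j • truncatedNoise G P γ r φ p R x i j = 0 := by
  unfold truncatedNoise
  split_ifs
  · exact sum_smul_tdNoise hP x i
  · simp

/-- The discounted noise, from time `n₀` on, along a trajectory. -/
noncomputable def noiseSum (G P : Matrix S S ℝ) (γ : ℝ) (r : S → ℝ)
    (φ : S → EuclideanSpace ℝ (Fin d)) (a : ℕ → ℝ) (p : EuclideanSpace ℝ (Fin d)) (R : ℝ) (n₀ : ℕ)
    (y : ℕ → S) (x₀ : EuclideanSpace ℝ (Fin d)) (k : ℕ) : EuclideanSpace ℝ (Fin d) :=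
  discountedSum (fun l => a (n₀ + l)) (fun l => truncatedNoise G P γ r φ p R
    (iterate γ r φ a y x₀ (n₀ + l)) (y (n₀ + l)) (y (n₀ + l + 1))) k

/-- The pathwise error bound for TD(0): it holds at time `n₀ + m` on every trajectory that is within
`ε` of the fixed point at time `n₀` and whose discounted noise stays at most `δ` afterwards. -/
theorem norm_iterate_sub_le [DecidableEq S] {π : S → ℝ} {d₁ d₂ d₃ α A L R δ ε : ℝ}
    (hG : ∀ i k, G i k - ∑ j, P i j * G j k = (1 : Matrix S S ℝ) i k - π k)
    (ha : IsStepsize a d₁ d₂ d₃) (hα : 0 ≤ α)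
    (hT : ∀ x y, ‖meanF P π γ r φ x - meanF P π γ r φ y‖ ≤ α * ‖x - y‖)
    {p : EuclideanSpace ℝ (Fin d)} (hp : meanF P π γ r φ p = p) (hA : 0 ≤ A) (hL : 0 ≤ L)
    (hV : ∀ i x, ‖poissonSolution G P γ r φ i x‖ ≤ A + L * ‖x - p‖)
    (hVx : ∀ x i j k (s : ℝ), 0 ≤ s →
      ‖poissonSolution G P γ r φ k (x + s • tdIncrement γ r φ x i j)
        - poissonSolution G P γ r φ k x‖ ≤ s * (A + L * ‖x - p‖))
    (hδ : 0 ≤ δ) (hε : 0 ≤ ε) {n₀ : ℕ} (hn₀ : 0 < n₀) (hden : α + a n₀ * (4 * L) < 1)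
    (hR : ε + (a n₀ * (4 * A + 4 * L * ε) + δ) / (1 - α - a n₀ * (4 * L)) ≤ R)
    {y : ℕ → S} {x₀ : EuclideanSpace ℝ (Fin d)} (hinit : ‖iterate γ r φ a y x₀ n₀ - p‖ ≤ ε)
    {m : ℕ} (hnoise : ∀ k, 0 < k → k ≤ m → ‖noiseSum G P γ r φ a p R n₀ y x₀ k‖ ≤ δ) :
    ‖iterate γ r φ a y x₀ (n₀ + m) - p‖ ≤ errorBound α a (4 * L) (4 * A) δ ε n₀ (n₀ + m) := by
  rw [errorBound, bSum_eq_sum_range hn₀]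
  refine norm_sub_le_of_discountedSum_le (a := fun l => a (n₀ + l))
    (x := fun l => iterate γ r φ a y x₀ (n₀ + l))
    (v := fun l => poissonSolution G P γ r φ (y (n₀ + l)))
    (N := fun l => truncatedNoise G P γ r φ p R (iterate γ r φ a y x₀ (n₀ + l)) (y (n₀ + l))
      (y (n₀ + l + 1))) (R := R)
    (fun l => ha.pos _) (fun l => ha.lt_one _)
    (antitone_nat_of_succ_le fun l => ha.antitone (n₀ + l)) hα hT hp hA hL (fun l => hV _)
    (fun l => ?_) (fun l hl => ?_) hδ hε hinit hden hR (fun k hk => ?_)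
  · rw [← add_assoc, iterate_succ]
    exact hVx (iterate γ r φ a y x₀ (n₀ + l)) (y (n₀ + l)) (y (n₀ + l + 1)) (y (n₀ + l + 1))
      (a (n₀ + l)) (ha.pos (n₀ + l)).le
  · beta_reduce at hl
    rw [← add_assoc, iterate_succ, tdIncrement_eq hG, truncatedNoise, if_pos hl]
  · rcases Nat.eq_zero_or_pos k with rfl | hk₀
    · simpa [discountedSum] using hδ
    · exact hnoise k hk₀ hk

/-- The probability that the discounted noise exceeds `δ`, with the variance replaced by its bound
of the order of `β`. -/
theorem IsMarkovChain.measure_noiseSum_le [DecidableEq S] [MeasurableSpace S]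
    [MeasurableSingletonClass S] {Ω : Type*} [MeasurableSpace Ω] {μ : Measure Ω}
    [IsProbabilityMeasure μ] {x₀ : Ω → EuclideanSpace ℝ (Fin d)} {Y : ℕ → Ω → S}
    (hM : IsMarkovChain P μ x₀ Y) (hd : 1 ≤ d) (hP : P ∈ Matrix.rowStochastic ℝ S)
    {d₁ d₂ d₃ : ℝ} (ha : IsStepsize a d₁ d₂ d₃) {p : EuclideanSpace ℝ (Fin d)} {R c : ℝ}
    (hc : 0 < c) (hR : ∀ x, ‖x - p‖ ≤ R → ∀ i j, ‖tdNoise G P γ r φ x i j‖ ≤ c)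
    {n₀ : ℕ} (hn₀ : 0 < n₀) {δ : ℝ} (hδ : 0 < δ) (k : ℕ) :
    μ.real {ω | δ < ‖noiseSum G P γ r φ a p R n₀ (fun l => Y l ω) (x₀ ω) k‖}
      ≤ 2 * d * Real.exp (-(1 / (2 * d * c ^ 2 * (d₃ * 2 ^ min d₁ d₂))) * δ ^ 2
        / beta d₁ d₂ n₀ (n₀ + k)) := by
  have hβ : 0 < beta d₁ d₂ n₀ (n₀ + k) := beta_pos hn₀ (by omega)
  have hd₃ := ha.d₃_pos
  have hrow := Matrix.sum_row_of_mem_rowStochastic hP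
  have hmeas : ∀ k j, Measurable[history x₀ Y (n₀ + k)] fun ω => truncatedNoise G P γ r φ p R
      (iterate γ r φ a (fun l => Y l ω) (x₀ ω) (n₀ + k)) (Y (n₀ + k) ω) j := by
    intro k j
    exact measurable_comp_prod_countable (g := fun x i => truncatedNoise G P γ r φ p R x i j)
      (fun i => measurable_truncatedNoise p R i j) (measurable_iterate (n₀ + k))
      (measurable_history_state le_rfl)
  have hbound : ∀ x i j, ‖truncatedNoise G P γ r φ p R x i j‖ ≤ c := by
    intro x i j
    unfold truncatedNoise
    split_ifs with h
    · exact hR x h i j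
    · simpa using hc.le
  refine (hM.measure_norm_discountedSum_le hd hP (a := fun l => a (n₀ + l)) (fun l => ha.pos _)
    (fun l => ha.lt_one _) n₀ (ξ := fun k ω j => truncatedNoise G P γ r φ p R
      (iterate γ r φ a (fun l => Y l ω) (x₀ ω) (n₀ + k)) (Y (n₀ + k) ω) j) hmeas
    (fun k ω => sum_smul_truncatedNoise hrow p R _ _) hc (fun k ω j => hbound _ _ _) k
    (σ := d₃ * 2 ^ min d₁ d₂ * beta d₁ d₂ n₀ (n₀ + k)) (by positivity)
    (ha.discountedVariance_le hn₀ k) hδ).trans_eq ?_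
  congr 2
  field_simp

end Iterates

end TD0

/-! ### The concentration bound -/

theorem theorem1 {S : Type*} [Fintype S] [DecidableEq S] [MeasurableSpace S]
    [MeasurableSingletonClass S] {d : ℕ} (hd : 1 ≤ d)
    (P : Matrix S S ℝ) (hP : P ∈ Matrix.rowStochastic ℝ S)
    (hirr : P.IsIrreducible) (haper : TD0.IsAperiodic P)
    (π : S → ℝ) (hπ : TD0.IsStationary P π)
    (γ : ℝ) (hγ₀ : 0 < γ) (hγ₁ : γ < 1) (r : S → ℝ)
    (φ : S → EuclideanSpace ℝ (Fin d))
    (hφ : LinearIndependent ℝ fun (l : Fin d) (i : S) => φ i l)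
    (hscale : TD0.lambdaM π φ < Real.sqrt (2 * (1 - γ)) / (1 + γ)) :
    TD0.contractionFactor π γ φ < 1 ∧
    ∃ xstar : EuclideanSpace ℝ (Fin d),
      (∀ x, TD0.meanF P π γ r φ x = x ↔ x = xstar) ∧
      ∃ c₁ c₂ c₃ : ℝ, 0 < c₁ ∧ 0 < c₂ ∧ 0 < c₃ ∧
        ∀ (a : ℕ → ℝ) (d₁ d₂ d₃ : ℝ), TD0.IsStepsize a d₁ d₂ d₃ →
        ∃ D : ℝ, 0 < D ∧
          ∀ (Ω : Type*) [MeasurableSpace Ω] (μ : Measure Ω) [IsProbabilityMeasure μ]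
            (x₀ : Ω → EuclideanSpace ℝ (Fin d)) (Y : ℕ → Ω → S),
            TD0.IsMarkovChain P μ x₀ Y →
          ∀ (x : ℕ → Ω → EuclideanSpace ℝ (Fin d)),
            (∀ n ω, x n ω = TD0.iterate γ r φ a (fun k => Y k ω) (x₀ ω) n) →
          ∀ (δ ε : ℝ), 0 < δ → δ ≤ 1 → 0 < ε → ε ≤ 1 →
          ∀ n₀ : ℕ, 0 < n₀ → TD0.contractionFactor π γ φ + a n₀ * c₁ < 1 →
            -- part (a)
            (∀ n : ℕ, n₀ ≤ n →
              (1 - 2 * (d : ℝ) * ∑ m ∈ Finset.Icc (n₀ + 1) n,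
                    Real.exp (-D * δ ^ 2 / TD0.beta d₁ d₂ n₀ m)
                  - μ.real {ω | ε < ‖x n₀ ω - xstar‖}
                ≤ μ.real {ω | ∀ m, n₀ ≤ m → m ≤ n → ‖x m ω - xstar‖ ≤
                    TD0.errorBound (TD0.contractionFactor π γ φ) a c₁ c₂ δ ε n₀ m}) ∧
              (n₀ < n →
                1 - 2 * (d : ℝ) * ∑ m ∈ Finset.Icc (n₀ + 1) n,
                    Real.exp (-D * δ ^ 2 / TD0.beta d₁ d₂ n₀ m)
                  - μ.real {ω | ε < ‖x n₀ ω - xstar‖}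
                < μ.real {ω | ∀ m, n₀ ≤ m → m ≤ n → ‖x m ω - xstar‖ ≤
                    TD0.errorBound (TD0.contractionFactor π γ φ) a c₁ c₂ δ ε n₀ m})) ∧
            -- part (b); the sum runs over all `m ≥ n₀ + 1`, written as `m = n₀ + 1 + k`
            (Summable fun k : ℕ => Real.exp (-D * δ ^ 2 / TD0.beta d₁ d₂ n₀ (n₀ + 1 + k))) ∧
            1 - 2 * (d : ℝ) * ∑' k : ℕ,
                  Real.exp (-D * δ ^ 2 / TD0.beta d₁ d₂ n₀ (n₀ + 1 + k))
                - μ.real {ω | ε < ‖x n₀ ω - xstar‖}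
              < μ.real {ω | ∀ m, n₀ ≤ m → ‖x m ω - xstar‖ ≤
                  TD0.errorBound (TD0.contractionFactor π γ φ) a c₁ c₂ δ ε n₀ m} := by
  have hπ₀ := fun i => TD0.IsStationary.pos hirr hπ i
  have hα₁ := TD0.contractionFactor_lt_one hd hπ₀ hγ₀ hγ₁ hφ hscale
  have hα₀ : 0 ≤ TD0.contractionFactor π γ φ := Real.sqrt_nonneg _
  have hT := TD0.norm_meanF_sub_meanF_le (r := r) hP hπ hγ₀ hγ₁ hscale
  refine ⟨hα₁, ?_⟩
  obtain ⟨p, hp⟩ := TD0.exists_fixedPoint hα₀ hα₁ hT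
  obtain ⟨G, hG⟩ := TD0.exists_fundamental_matrix hP hirr hπ
  obtain ⟨A, L, hA, hL, hV, hVx⟩ :=
    TD0.exists_growth_constants (G := G) (P := P) (r := r) (φ := φ) hγ₀ p
  refine ⟨p, hp, 4 * L, 4 * A, 1, by positivity, by positivity, one_pos, ?_⟩
  set α := TD0.contractionFactor π γ φ with hα
  intro a d₁ d₂ d₃ ha
  by_cases hex : ∃ n, 0 < n ∧ α + a n * (4 * L) < 1
  swap
  · exact ⟨1, one_pos, fun Ω _ μ _ x₀ Y _ x _ δ ε _ _ _ _ n₀ hn₀ hden =>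
      absurd ⟨n₀, hn₀, hden⟩ hex⟩
  classical
  have hanti : Antitone a := antitone_nat_of_succ_le ha.antitone
  -- The first admissible `n₀` has the largest stepsize, so the smallest denominator `η`. This makes
  -- the radius `R` a bound for all admissible `n₀` at once.
  have hη : 0 < 1 - α - a (Nat.find hex) * (4 * L) := by linarith [(Nat.find_spec hex).2]
  set η := 1 - α - a (Nat.find hex) * (4 * L) with hη_def
  set R := 1 + (4 * A + 4 * L + 1) / η with hR_def
  obtain ⟨c, hc, hcR⟩ :=
    TD0.exists_norm_tdNoise_le (G := G) (P := P) (γ := γ) (r := r) (φ := φ) p R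
  have hd' : (0 : ℝ) < d := by exact_mod_cast hd
  have hd₃ := ha.d₃_pos
  set κ := 1 / (2 * d * c ^ 2 * (d₃ * 2 ^ min d₁ d₂)) with hκ_def
  have hκ : 0 < κ := by positivity
  -- Halving the exponent makes the inequalities strict.
  refine ⟨κ / 2, by positivity, ?_⟩
  intro Ω _ μ _ x₀ Y hM x hx δ ε hδ₀ hδ₁ hε₀ hε₁ n₀ hn₀ hden
  obtain rfl : x = fun n ω => TD0.iterate γ r φ a (fun k => Y k ω) (x₀ ω) n :=
    funext fun n => funext fun ω => hx n ω
  have hR : ε + (a n₀ * (4 * A + 4 * L * ε) + δ) / (1 - α - a n₀ * (4 * L)) ≤ R := by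
    have h₁ : a n₀ ≤ a (Nat.find hex) := hanti (Nat.find_min' hex ⟨hn₀, hden⟩)
    have h₂ : η ≤ 1 - α - a n₀ * (4 * L) := by
      have := mul_le_mul_of_nonneg_right h₁ (by positivity : 0 ≤ 4 * L)
      linarith
    have h₃ : a n₀ * (4 * A + 4 * L * ε) + δ ≤ 4 * A + 4 * L + 1 := by
      have h₄ : 4 * A + 4 * L * ε ≤ 4 * A + 4 * L := by nlinarith
      have h₅ := mul_le_of_le_one_left (by positivity : 0 ≤ 4 * A + 4 * L * ε) (ha.lt_one n₀).le
      linarith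
    exact add_le_add hε₁ (div_le_div₀ (by positivity) h₃ hη h₂)
  set B : Set Ω := {ω | ε < ‖TD0.iterate γ r φ a (fun k => Y k ω) (x₀ ω) n₀ - p‖} with hB
  set C : ℕ → Set Ω := fun m =>
    {ω | δ < ‖TD0.noiseSum G P γ r φ a p R n₀ (fun l => Y l ω) (x₀ ω) (m - n₀)‖} with hC
  have hpath : ∀ ω, ω ∉ B → ∀ m, n₀ ≤ m → (∀ k, n₀ + 1 ≤ k → k ≤ m → ω ∉ C k) →
      ‖TD0.iterate γ r φ a (fun k => Y k ω) (x₀ ω) m - p‖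
        ≤ TD0.errorBound α a (4 * L) (4 * A) δ ε n₀ m := by
    intro ω hωB m hm hωC
    obtain ⟨k, rfl⟩ := Nat.exists_eq_add_of_le hm
    refine TD0.norm_iterate_sub_le hG ha hα₀ hT ((hp p).2 rfl) hA.le hL.le hV hVx hδ₀.le hε₀.le hn₀
      hden hR (not_lt.1 hωB) fun l hl hlk => ?_
    have h : ‖TD0.noiseSum G P γ r φ a p R n₀ (fun l => Y l ω) (x₀ ω) (n₀ + l - n₀)‖ ≤ δ :=
      not_lt.1 (hωC (n₀ + l) (by omega) (by omega))
    rwa [Nat.add_sub_cancel_left] at h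
  have htail : ∀ m, n₀ ≤ m →
      μ.real (C m) ≤ 2 * d * Real.exp (-κ * δ ^ 2 / TD0.beta d₁ d₂ n₀ m) := by
    intro m hm
    have h := hM.measure_noiseSum_le hd hP ha hc hcR hn₀ hδ₀ (m - n₀)
    rwa [Nat.add_sub_cancel' hm] at h
  have hlt : ∀ m, n₀ ≤ m → 2 * d * Real.exp (-κ * δ ^ 2 / TD0.beta d₁ d₂ n₀ m)
      < 2 * d * Real.exp (-(κ / 2) * δ ^ 2 / TD0.beta d₁ d₂ n₀ m) := by
    intro m hm
    have hβ : 0 < TD0.beta d₁ d₂ n₀ m := TD0.beta_pos hn₀ (by omega)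
    refine mul_lt_mul_of_pos_left (Real.exp_lt_exp.2 ?_) (by positivity)
    refine div_lt_div_of_pos_right ?_ hβ
    nlinarith [mul_pos hκ (pow_pos hδ₀ 2)]
  refine ⟨fun n hn => ?_, TD0.summable_exp_div_beta ha.d₁_pos ha.d₂_pos (by positivity) hδ₀ hn₀, ?_⟩
  · have h := TD0.one_sub_sum_le_measureReal (μ := μ) (B := B) (C := C)
      (A := {ω | ∀ m, n₀ ≤ m → m ≤ n → ‖TD0.iterate γ r φ a (fun k => Y k ω) (x₀ ω) m - p‖
        ≤ TD0.errorBound α a (4 * L) (4 * A) δ ε n₀ m}) (s := Finset.Icc (n₀ + 1) n)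
      (fun ω hωB hωC m hm hmn => hpath ω hωB m hm fun k hk hkm =>
        hωC k (Finset.mem_Icc.2 ⟨hk, hkm.trans hmn⟩))
      fun m hm => htail m (by have := (Finset.mem_Icc.1 hm).1; omega)
    have hsum : ∀ m ∈ Finset.Icc (n₀ + 1) n,
        2 * (d : ℝ) * Real.exp (-κ * δ ^ 2 / TD0.beta d₁ d₂ n₀ m)
          < 2 * d * Real.exp (-(κ / 2) * δ ^ 2 / TD0.beta d₁ d₂ n₀ m) :=
      fun m hm => hlt m (by have := (Finset.mem_Icc.1 hm).1; omega)
    rw [Finset.mul_sum]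
    constructor
    · have h₁ := Finset.sum_le_sum fun m hm => (hsum m hm).le
      linarith
    · intro hnn
      have h₁ := Finset.sum_lt_sum_of_nonempty (Finset.nonempty_Icc.2 hnn) hsum
      linarith
  · have hs₁ := (TD0.summable_exp_div_beta (n₀ := n₀) ha.d₁_pos ha.d₂_pos hκ hδ₀ hn₀).mul_left
      (2 * (d : ℝ))
    have hs₂ := (TD0.summable_exp_div_beta (n₀ := n₀) ha.d₁_pos ha.d₂_pos (half_pos hκ) hδ₀
      hn₀).mul_left (2 * (d : ℝ))
    have h := TD0.one_sub_tsum_le_measureReal (μ := μ) (B := B) (C := fun k => C (n₀ + 1 + k))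
      (A := {ω | ∀ m, n₀ ≤ m → ‖TD0.iterate γ r φ a (fun k => Y k ω) (x₀ ω) m - p‖
        ≤ TD0.errorBound α a (4 * L) (4 * A) δ ε n₀ m}) hs₁
      (fun ω hωB hωC m hm => hpath ω hωB m hm fun k hk _ => by
        have h := hωC (k - (n₀ + 1))
        rwa [Nat.add_sub_cancel' hk] at h)
      fun k => htail _ (by omega)
    have hlt' := hs₁.tsum_lt_tsum (fun k => (hlt (n₀ + 1 + k) (by omega)).le)
      (hlt (n₀ + 1 + 0) (by omega)) hs₂
    rw [← tsum_mul_left]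
    linarith
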